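/- Let $d\ge1$, let $\sigma$ be a $\sigma$-finite Borel measure on $\mathbb{R}^d$ and let $S\subseteq\mathbb{R}^d$ be a Borel set with $\sigma(\mathbb{R}^d\setminus S)=0$. Let $\widehat f(\xi)=\int_{\mathbb{R}^d} f(x)e^{-2\pi i x\cdot\xi}\,dx$, extended to $L^s(\mathbb{R}^d)$, $s\ge 1$, in the sense of tempered distributions. For $r=(r_1,\dots,r_d)\in(0,\infty)^d$ and a Schwartz function $\chi$ put $\chi_{r}(x)=\frac1{r_1\cdots r_d}\chi\big(\frac{x_1}{r_1},\dots,\frac{x_d}{r_d}\big)$, and let $B_{r}(y)=\{x:\sum_j (x_j-y_j)^2/r_j^2\le1\}$, with volume $|B_r|$. Suppose that the exponents $1<p<q<\infty$ are such that, for some finite constant $C_0$, $$\big\|\widehat f\,|_S\big\|_{L^q(S,\sigma)}\le C_0\|f\|_{L^p(\mathbb{R}^d)}\quad\text{for every Schwartz function } f.$$ Then for every $1\le s\le p$ there is a unique bounded linear operator $\mathcal R\colon L^s(\mathbb{R}^d)\to L^{qs'/p'}(S,\sigma)$ such that $\mathcal Rf=\widehat f|_S$ for every Schwartz function $f$ (here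 $1/p+1/p'=1=1/s+1/s'$, and $qs'/p'=\infty$ when $s=1$), and the following hold. (a) For every Schwartz function $\chi$ there is a finite constant $C$ such that for every $f\in L^p(\mathbb{R}^d)$ the function $\sup_{r\in(0,\infty)^d}|\widehat f*\chi_r|$ is measurable and $$\Big\|\sup_{r\in(0,\infty)^d}\big|\widehat f*\chi_{r}\big|\Big\|_{L^q(S,\sigma)}\le C\|f\|_{L^p(\mathbb{R}^d)}.$$ (b) For every Schwartz function $\chi$ with $\int_{\mathbb{R}^d}\chi=1$ and every $f\in L^s(\mathbb{R}^d)$, $1\le s\le p$, $$\lim_{(0,\infty)^d\ni r\to 0}(\widehat f*\chi_{r})(\xi)=(\mathcal Rf)(\xi)\quad\text{for }\sigma\text{-a.e. }\xi\in S.$$ (c) If $f\in L^s(\mathbb{R}^d)$ with $1\le s\le 2p/(p+1)$, then $\widehat f$ is a locally integrable function and $$\lim_{(0,\infty)^d\ni r\to0}\frac1{|B_r|}\int_{B_r(\xi)}\big|\widehat f(\eta)-(\mathcal Rf)(\xi)\big|\,d\eta=0\quad\text{for }\sigma\text{-a.e. }\xi\in S;$$ in particular, for $\sigma$-a.e. $\xi\in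 S$, $$\lim_{(0,\infty)^d\ni r\to0}\frac1{|B_r|}\int_{B_r(\xi)}\widehat f(\eta)\,d\eta=(\mathcal Rf)(\xi).$$ -/

import Mathlib

open MeasureTheory Filter Topology SchwartzMap
open scoped ENNReal NNReal FourierTransform

noncomputable section

namespace FourierRestriction

/-- The parameter set `(0,∞)^d`. -/
abbrev PosParam (d : ℕ) : Type := {r : Fin d → ℝ // ∀ j, 0 < r j}

/-- The filter describing `(r_1,…,r_d) → (0,…,0)` within `(0,∞)^d`. -/
def toZero (d : ℕ) : Filter (PosParam d) :=
  comap (fun r : PosParam d => (r : Fin d → ℝ)) (𝓝 0)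

/-- The invertible linear map `(x_1,…,x_d) ↦ (x_1/r_1,…,x_d/r_d)`. -/
def scaling {d : ℕ} (r : PosParam d) :
    EuclideanSpace ℝ (Fin d) ≃L[ℝ] EuclideanSpace ℝ (Fin d) :=
  LinearEquiv.toContinuousLinearEquiv
    { toFun := fun x => WithLp.toLp 2 fun j => x j / r.1 j
      invFun := fun x => WithLp.toLp 2 fun j => x j * r.1 j
      map_add' := fun x y => by ext j; simp [add_div]
      map_smul' := fun c x => by ext j; simp [mul_div_assoc]
      left_inv := fun x => by ext j; simp [(r.2 j).ne']
      right_inv := fun x => by ext j; simp [(r.2 j).ne'] }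

/-- The multi-parameter dilate
`χ_{r_1,…,r_d}(x) = (r_1 ⋯ r_d)⁻¹ χ(x_1/r_1, …, x_d/r_d)` of a Schwartz function. -/
def dilate {d : ℕ} (χ : 𝓢(EuclideanSpace ℝ (Fin d), ℂ)) (r : PosParam d) :
    𝓢(EuclideanSpace ℝ (Fin d), ℂ) :=
  ((∏ j, r.1 j)⁻¹ : ℝ) • compCLMOfContinuousLinearEquiv ℂ (scaling r) χ

theorem dilate_apply {d : ℕ} (χ : 𝓢(EuclideanSpace ℝ (Fin d), ℂ)) (r : PosParam d)
    (x : EuclideanSpace ℝ (Fin d)) :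
    dilate χ r x = ((∏ j, r.1 j)⁻¹ : ℝ) • χ (WithLp.toLp 2 fun j => x j / r.1 j) := rfl

/-- The Schwartz function `η ↦ φ(ξ - η)`. -/
def reflectAt {d : ℕ} (φ : 𝓢(EuclideanSpace ℝ (Fin d), ℂ)) (ξ : EuclideanSpace ℝ (Fin d)) :
    𝓢(EuclideanSpace ℝ (Fin d), ℂ) :=
  compSubConstCLM ℂ ξ (compCLMOfContinuousLinearEquiv ℂ (ContinuousLinearEquiv.neg ℝ) φ)

theorem reflectAt_apply {d : ℕ} (φ : 𝓢(EuclideanSpace ℝ (Fin d), ℂ))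
    (ξ η : EuclideanSpace ℝ (Fin d)) : reflectAt φ ξ η = φ (ξ - η) := by
  simp [reflectAt]

/-- The convolution `u ∗ φ` of a tempered distribution and a Schwartz function, which is the
function `ξ ↦ ⟨u, φ(ξ - ·)⟩`. -/
def conv {d : ℕ} (u : 𝓢'(EuclideanSpace ℝ (Fin d), ℂ)) (φ : 𝓢(EuclideanSpace ℝ (Fin d), ℂ))
    (ξ : EuclideanSpace ℝ (Fin d)) : ℂ :=
  u (reflectAt φ ξ)

/-- The Fourier transform of `f ∈ L^s(ℝ^d)`, as a tempered distribution. -/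
def fourierLp {d : ℕ} {s : ℝ≥0∞} [Fact (1 ≤ s)]
    (f : Lp ℂ s (volume : Measure (EuclideanSpace ℝ (Fin d)))) :
    𝓢'(EuclideanSpace ℝ (Fin d), ℂ) :=
  𝓕 (Lp.toTemperedDistribution f)

/-- The tempered distribution `u` is (given by integration against) the function `F`. -/
structure IsGivenBy {d : ℕ} (u : 𝓢'(EuclideanSpace ℝ (Fin d), ℂ))
    (F : EuclideanSpace ℝ (Fin d) → ℂ) : Prop where
  locallyIntegrable : LocallyIntegrable F volume
  integrable : ∀ φ : 𝓢(EuclideanSpace ℝ (Fin d), ℂ), Integrable (fun η => φ η * F η) volume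
  apply_eq : ∀ φ : 𝓢(EuclideanSpace ℝ (Fin d), ℂ), u φ = ∫ η, φ η * F η

/-- The a priori restriction estimate `‖f̂‖_{L^q(ν)} ≲ ‖f‖_{L^p(ℝ^d)}` for Schwartz functions. -/
def APrioriEstimate {d : ℕ} (ν : Measure (EuclideanSpace ℝ (Fin d))) (p q : ℝ≥0∞) : Prop :=
  ∃ C : ℝ≥0, ∀ φ : 𝓢(EuclideanSpace ℝ (Fin d), ℂ),
    eLpNorm (𝓕 φ : 𝓢(EuclideanSpace ℝ (Fin d), ℂ)) q ν ≤ C * eLpNorm φ p volume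

/-- `R` is a Fourier restriction operator `L^s(ℝ^d) → L^t(ν)`: a bounded linear operator with
`R φ = φ̂` (`ν`-almost everywhere) for every Schwartz function `φ`. -/
structure IsRestrictionOperator {d : ℕ} (ν : Measure (EuclideanSpace ℝ (Fin d))) (s t : ℝ≥0∞)
    (R : Lp ℂ s (volume : Measure (EuclideanSpace ℝ (Fin d))) →ₗ[ℂ] Lp ℂ t ν) : Prop where
  bounded : ∃ C : ℝ, ∀ f, ‖R f‖ ≤ C * ‖f‖
  eq_fourier : ∀ φ : 𝓢(EuclideanSpace ℝ (Fin d), ℂ),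
    R (φ.toLp s volume) =ᵐ[ν] (𝓕 φ : 𝓢(EuclideanSpace ℝ (Fin d), ℂ))

/-- The ellipsoid `B_{r_1,…,r_d}(y)` with centre `y` and semi-axes `r_1,…,r_d`. -/
def ellipsoid {d : ℕ} (r : PosParam d) (y : EuclideanSpace ℝ (Fin d)) :
    Set (EuclideanSpace ℝ (Fin d)) :=
  {x | ∑ j, (x j - y j) ^ 2 / r.1 j ^ 2 ≤ 1}

/-- The multi-parameter maximal function `sup_{r_1,…,r_d > 0} |u ∗ χ_{r_1,…,r_d}|`. -/
def maximalFunction {d : ℕ} (u : 𝓢'(EuclideanSpace ℝ (Fin d), ℂ))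
    (χ : 𝓢(EuclideanSpace ℝ (Fin d), ℂ)) (ξ : EuclideanSpace ℝ (Fin d)) : ℝ≥0∞ :=
  ⨆ r : PosParam d, ‖conv u (dilate χ r) ξ‖ₑ

end FourierRestriction

end

/-! For `f ∈ L^p` the function `f̂ * χ_r` is the Fourier transform of `f(x) χ̌(r_1 x_1, …, r_d
x_d)`, so (a) asks for a bound on the restriction estimate uniform over a family of multipliers.
Integrating its mixed derivative writes a Schwartz function as a superposition, with integrable
density, of indicators of octants `{x_j < t_j for all j}`. Scaling coordinates maps octants to
octants, so the supremum over `r` is at most a constant times the supremum over octants `O` of `|𝓕(f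
1_O)|`. An octant is an intersection of `d` half-spaces, and half-spaces in one direction form a
chain. Since `p < q`, the Christ-Kiselev lemma, in a form valid for sublinear operators, can be
applied once per coordinate (`exists_eLpNorm_maximalFunction_le`).

The restriction operator on `L^s` comes from density of Schwartz functions and from real
interpolation of the `L^p → L^q` estimate with the trivial `L^1 → L^∞` one
(`exists_eLpNorm_fourier_le_of_lt`). The interpolated exponent exceeds `s`, so the maximal estimate
is available for every `1 < s ≤ p`, and (b) follows by comparing `f` with Schwartz functions, for
which convergence holds everywhere. For `s = 1` the transform is continuous and nothing maximal is
needed.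

For (c) absolute values stand inside the averages, so cancellation in `f̂ * χ_r` cannot be used
directly. For Schwartz `φ`, however, `|φ̂|²` is the Fourier transform of the autocorrelation `η` of
`φ`. By Jensen, the squared average of `|φ̂|` over an ellipsoid is at most the average of `η̂ ≥ 0`,
hence at most a constant times a convolution `|η̂ * χ_r|` with a bump `χ`. Young's inequality places
`η` in `L^{s/(2-s)}`, and `s/(2-s) ≤ p` is exactly the condition `s ≤ 2p/(p+1)`. Hausdorff-Young,
again by interpolation, makes `f̂` a function. -/

namespace FourierRestriction

/-! ### The Christ-Kiselev lemma for sublinear operators. -/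

section ChristKiselev

variable {X Y ι : Type*} [MeasurableSpace X] [MeasurableSpace Y]

/-- `N` is a sublinear operator which is bounded from `L^p(μ)` to `L^q(ν)` with constant `C`. -/
structure IsSublinearBounded (μ : Measure X) (ν : Measure Y) (p q : ℝ≥0∞) (C : ℝ≥0)
    (N : (X → ℂ) → Y → ℝ≥0∞) : Prop where
  measurable : ∀ f, MemLp f p μ → Measurable (N f)
  add_le : ∀ f g, MemLp f p μ → MemLp g p μ → ∀ y, N (f + g) y ≤ N f y + N g y
  bound : ∀ f, MemLp f p μ → eLpNorm (N f) q ν ≤ C * eLpNorm f p μ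

theorem eLpNorm_rpow_eq_lintegral {ε : Type*} [ENorm ε] {μ : Measure X} {p : ℝ≥0∞} (hp : p ≠ 0)
    (hp' : p ≠ ∞) (f : X → ε) : eLpNorm f p μ ^ p.toReal = ∫⁻ x, ‖f x‖ₑ ^ p.toReal ∂μ := by
  rw [eLpNorm_eq_lintegral_rpow_enorm_toReal hp hp', ← ENNReal.rpow_mul, one_div,
    inv_mul_cancel₀ (ENNReal.toReal_pos hp hp').ne', ENNReal.rpow_one]

theorem eLpNorm_indicator_rpow {μ : Measure X} {p : ℝ≥0∞} (hp : p ≠ 0) (hp' : p ≠ ∞) (f : X → ℂ)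
    {A : Set X} (hA : MeasurableSet A) :
    eLpNorm (A.indicator f) p μ ^ p.toReal = ∫⁻ x in A, ‖f x‖ₑ ^ p.toReal ∂μ := by
  rw [eLpNorm_indicator_eq_eLpNorm_restrict hA, eLpNorm_rpow_eq_lintegral hp hp']

/-- The largest of the functions `N (f 1_{A i})`, where `i` runs through `s`. -/
noncomputable def finsetMax (N : (X → ℂ) → Y → ℝ≥0∞) (A : ι → Set X) (s : Finset ι)
    (f : X → ℂ) (y : Y) : ℝ≥0∞ :=
  ⨆ i ∈ s, N ((A i).indicator f) y

variable {μ : Measure X} {ν : Measure Y} {p q : ℝ≥0∞} {C : ℝ≥0} {N : (X → ℂ) → Y → ℝ≥0∞}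
  {A : ι → Set X}

theorem IsSublinearBounded.measurable_finsetMax (hN : IsSublinearBounded μ ν p q C N)
    (hA : ∀ i, MeasurableSet (A i)) (s : Finset ι) {f : X → ℂ} (hf : MemLp f p μ) :
    Measurable (finsetMax N A s f) :=
  Measurable.biSup _ s.countable_toSet fun i _ => hN.measurable _ (hf.indicator (hA i))

/-- A maximum is at most a sum. This crude bound only supplies a finite constant from which the
bisection iteration can start. -/
theorem IsSublinearBounded.finsetMax_le_card (hN : IsSublinearBounded μ ν p q C N) (hq : 1 ≤ q)
    (hA : ∀ i, MeasurableSet (A i)) (s : Finset ι) {f : X → ℂ} (hf : MemLp f p μ) :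
    eLpNorm (finsetMax N A s f) q ν ≤ (s.card * C : ℝ≥0) * eLpNorm f p μ := by
  calc eLpNorm (finsetMax N A s f) q ν
      ≤ eLpNorm (∑ i ∈ s, N ((A i).indicator f)) q ν := by
        refine eLpNorm_mono_enorm fun y => ?_
        simp only [enorm_eq_self, Finset.sum_apply]
        exact iSup₂_le fun i hi =>
          Finset.single_le_sum (f := fun i => N ((A i).indicator f) y) (fun _ _ => zero_le) hi
    _ ≤ ∑ i ∈ s, eLpNorm (N ((A i).indicator f)) q ν :=
        eLpNorm_sum_le
          (fun i _ => (hN.measurable _ (hf.indicator (hA i))).aestronglyMeasurable) hq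
    _ ≤ ∑ _i ∈ s, C * eLpNorm f p μ := Finset.sum_le_sum fun i _ =>
        (hN.bound _ (hf.indicator (hA i))).trans (by gcongr; exact eLpNorm_indicator_le f)
    _ = (s.card * C : ℝ≥0) * eLpNorm f p μ := by
        simp [mul_assoc]

/-- The constant in the Christ-Kiselev lemma improves under bisection of the mass of `f`. -/
theorem IsSublinearBounded.finsetMax_improve [LinearOrder ι] (hN : IsSublinearBounded μ ν p q C N)
    (hp : 1 ≤ p) (hpq : p ≤ q) (hq : q ≠ ∞) (hA : ∀ i, MeasurableSet (A i)) (hmono : Monotone A)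
    (s : Finset ι) {D : ℝ≥0}
    (hD : ∀ t ⊆ s, ∀ f, MemLp f p μ → eLpNorm (finsetMax N A t f) q ν ≤ D * eLpNorm f p μ)
    {f : X → ℂ} (hf : MemLp f p μ) :
    eLpNorm (finsetMax N A s f) q ν
      ≤ (C + D * 2 ^ (1 / q.toReal - 1 / p.toReal) : ℝ≥0) * eLpNorm f p μ := by
  classical
  have hp0 : p ≠ 0 := (zero_lt_one.trans_le hp).ne'
  have hp' : p ≠ ∞ := ne_top_of_le_ne_top hq hpq
  have hq0 : q ≠ 0 := (zero_lt_one.trans_le (hp.trans hpq)).ne'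
  have hP : 0 < p.toReal := ENNReal.toReal_pos hp0 hp'
  have hQ : 0 < q.toReal := ENNReal.toReal_pos hq0 hq
  set w : X → ℝ≥0∞ := fun x => ‖f x‖ₑ ^ p.toReal
  set I := ∫⁻ x, w x ∂μ with hI
  have hIf : eLpNorm f p μ ^ p.toReal = I := eLpNorm_rpow_eq_lintegral hp0 hp' f
  have hItop : I ≠ ∞ := by
    rw [← hIf]; exact ENNReal.rpow_ne_top_of_nonneg hP.le hf.eLpNorm_ne_top
  -- The chain is cut at half of the mass `I` of `|f|^p`. `B₁` is the largest set of mass at most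
  -- `I/2` and `B₂` the smallest of larger mass, so `B₁` and `B₂ᶜ` each carry at most half. If one
  -- family is empty, `B₁ = ∅` or `B₂` is the whole space.
  set s₁ := s.filter fun i => 2 * ∫⁻ x in A i, w x ∂μ ≤ I with hs₁
  set s₂ := s.filter fun i => ¬ 2 * ∫⁻ x in A i, w x ∂μ ≤ I with hs₂
  set B₁ := ⋃ i ∈ s₁, A i with hB₁
  set B₂ := ⋂ i ∈ s₂, A i with hB₂
  have mB₁ : MeasurableSet B₁ := Finset.measurableSet_biUnion _ fun i _ => hA i
  have mB₂ : MeasurableSet B₂ := Finset.measurableSet_biInter _ fun i _ => hA i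
  have h₁ : 2 * ∫⁻ x in B₁, w x ∂μ ≤ I := by
    rcases s₁.eq_empty_or_nonempty with h | h
    · simp [hB₁, h]
    · have : B₁ = A (s₁.max' h) := by
        refine subset_antisymm (Set.iUnion₂_subset fun i hi => hmono (s₁.le_max' i hi)) ?_
        exact Set.subset_biUnion_of_mem (u := A) (s₁.max'_mem h)
      rw [this]
      exact (Finset.mem_filter.1 (s₁.max'_mem h)).2
  have h₂ : 2 * ∫⁻ x in B₂ᶜ, w x ∂μ ≤ I := by
    rcases s₂.eq_empty_or_nonempty with h | h
    · simp [hB₂, h]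
    · have : B₂ = A (s₂.min' h) := by
        refine subset_antisymm ?_ (Set.subset_iInter₂ fun i hi => hmono (s₂.min'_le i hi))
        exact Set.biInter_subset_of_mem (t := A) (s₂.min'_mem h)
      have h3 := (Finset.mem_filter.1 (s₂.min'_mem h)).2
      rw [← this, not_le] at h3
      have h4 : ∫⁻ x in B₂, w x ∂μ + ∫⁻ x in B₂ᶜ, w x ∂μ = I := lintegral_add_compl _ mB₂
      by_contra! h5
      have h6 : I + I < 2 * ∫⁻ x in B₂, w x ∂μ + 2 * ∫⁻ x in B₂ᶜ, w x ∂μ := ENNReal.add_lt_add h3 h5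
      rw [← mul_add, h4, two_mul] at h6
      exact lt_irrefl _ h6
  -- Halving the mass gains `2^(-1/p)` in the norm of `f`; adding the `q`-th powers of two such
  -- halves costs `2^(1/q)`. The net factor is `2^(1/q - 1/p)`.
  have key : ∀ {B : Set X}, MeasurableSet B → 2 * ∫⁻ x in B, w x ∂μ ≤ I → ∀ t ⊆ s,
      2 * eLpNorm (finsetMax N A t (B.indicator f)) q ν ^ q.toReal
        ≤ ((D * 2 ^ (1 / q.toReal - 1 / p.toReal) : ℝ≥0) * eLpNorm f p μ) ^ q.toReal := by
    intro B hB h t ht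
    have e1 : eLpNorm (B.indicator f) p μ ≤ (2 : ℝ≥0∞) ^ (-(1 / p.toReal)) * eLpNorm f p μ := by
      rw [← ENNReal.rpow_le_rpow_iff hP, ENNReal.mul_rpow_of_nonneg _ _ hP.le,
        eLpNorm_indicator_rpow hp0 hp' f hB, ← ENNReal.rpow_mul, hIf]
      rw [show -(1 / p.toReal) * p.toReal = -1 by field_simp, ENNReal.rpow_neg_one,
        ← ENNReal.mul_le_iff_le_inv (by simp) (by simp)]
      exact h
    have e2 : (2 : ℝ≥0∞) = ((2 : ℝ≥0∞) ^ (1 / q.toReal)) ^ q.toReal := by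
      rw [← ENNReal.rpow_mul, one_div, inv_mul_cancel₀ hQ.ne', ENNReal.rpow_one]
    conv_lhs => rw [e2]
    rw [← ENNReal.mul_rpow_of_nonneg _ _ hQ.le]
    refine ENNReal.rpow_le_rpow ?_ hQ.le
    calc (2 : ℝ≥0∞) ^ (1 / q.toReal) * eLpNorm (finsetMax N A t (B.indicator f)) q ν
        ≤ (2 : ℝ≥0∞) ^ (1 / q.toReal) * (D * ((2 : ℝ≥0∞) ^ (-(1 / p.toReal)) * eLpNorm f p μ)) := by
          gcongr
          exact (hD t ht _ (hf.indicator hB)).trans (by gcongr)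
      _ = _ := by
          rw [ENNReal.coe_mul, ENNReal.coe_rpow_of_ne_zero (by simp), sub_eq_add_neg,
            ENNReal.rpow_add _ _ (by simp) (by simp)]
          simp only [ENNReal.coe_ofNat]
          ring
  set M₁ := finsetMax N A s₁ (B₁.indicator f)
  set M₂ := finsetMax N A s₂ (B₂ᶜ.indicator f)
  have hM₁ : Measurable M₁ := hN.measurable_finsetMax hA _ (hf.indicator mB₁)
  have hM₂ : Measurable M₂ := hN.measurable_finsetMax hA _ (hf.indicator mB₂.compl)
  -- Light sets only see `f 1_{B₁}`. A heavy set contains `B₂`, so it contributes the single fixed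
  -- function `f 1_{B₂}`, paid for once by `C`, plus a piece of `f 1_{B₂ᶜ}`.
  have hpt : ∀ y, finsetMax N A s f y ≤ N (B₂.indicator f) y + max (M₁ y) (M₂ y) := by
    refine fun y => iSup₂_le fun i hi => ?_
    by_cases h : 2 * ∫⁻ x in A i, w x ∂μ ≤ I
    · have hi₁ : i ∈ s₁ := Finset.mem_filter.2 ⟨hi, h⟩
      have : (A i).indicator f = (A i).indicator (B₁.indicator f) := by
        rw [Set.indicator_indicator, Set.inter_eq_left.2]
        exact Set.subset_biUnion_of_mem (u := A) hi₁
      rw [this]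
      refine le_trans ?_ le_add_self
      exact (le_iSup₂ (f := fun i _ => N ((A i).indicator (B₁.indicator f)) y) i hi₁).trans
        (le_max_left _ _)
    · have hi₂ : i ∈ s₂ := Finset.mem_filter.2 ⟨hi, h⟩
      have : (A i).indicator f = B₂.indicator f + (A i).indicator (B₂ᶜ.indicator f) := by
        have hsub : B₂ ⊆ A i := Set.biInter_subset_of_mem (t := A) hi₂
        ext x
        by_cases h1 : x ∈ B₂
        · simp [h1, hsub h1]
        · by_cases h2 : x ∈ A i <;> simp [h1, h2]
      rw [this]
      refine (hN.add_le _ _ (hf.indicator mB₂) ((hf.indicator mB₂.compl).indicator (hA i)) y).trans ?_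
      gcongr
      exact (le_iSup₂ (f := fun i _ => N ((A i).indicator (B₂ᶜ.indicator f)) y) i hi₂).trans
        (le_max_right _ _)
  have hmax : eLpNorm (fun y => max (M₁ y) (M₂ y)) q ν
      ≤ (D * 2 ^ (1 / q.toReal - 1 / p.toReal) : ℝ≥0) * eLpNorm f p μ := by
    rw [← ENNReal.rpow_le_rpow_iff hQ, ← ENNReal.mul_le_mul_iff_right (two_ne_zero) (by simp),
      eLpNorm_rpow_eq_lintegral hq0 hq]
    calc 2 * ∫⁻ y, ‖max (M₁ y) (M₂ y)‖ₑ ^ q.toReal ∂ν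
        ≤ 2 * ∫⁻ y, (‖M₁ y‖ₑ ^ q.toReal + ‖M₂ y‖ₑ ^ q.toReal) ∂ν := by
          gcongr with y
          simp only [enorm_eq_self]
          rcases max_cases (M₁ y) (M₂ y) with h | h
          · rw [h.1]; exact le_self_add
          · rw [h.1]; exact le_add_self
      _ = 2 * eLpNorm M₁ q ν ^ q.toReal + 2 * eLpNorm M₂ q ν ^ q.toReal := by
          rw [lintegral_add_left (by simpa using hM₁.pow_const _), mul_add,
            eLpNorm_rpow_eq_lintegral hq0 hq, eLpNorm_rpow_eq_lintegral hq0 hq]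
      _ ≤ _ := by
          rw [two_mul ((_ * eLpNorm f p μ) ^ _)]
          exact add_le_add (key mB₁ h₁ s₁ (Finset.filter_subset _ _))
            (key mB₂.compl h₂ s₂ (Finset.filter_subset _ _))
  calc eLpNorm (finsetMax N A s f) q ν
      ≤ eLpNorm (N (B₂.indicator f) + fun y => max (M₁ y) (M₂ y)) q ν :=
        eLpNorm_mono_enorm fun y => by simpa using hpt y
    _ ≤ eLpNorm (N (B₂.indicator f)) q ν + eLpNorm (fun y => max (M₁ y) (M₂ y)) q ν :=
        eLpNorm_add_le (hN.measurable _ (hf.indicator mB₂)).aestronglyMeasurable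
          (hM₁.max hM₂).aestronglyMeasurable (hp.trans hpq)
    _ ≤ C * eLpNorm f p μ
        + (D * 2 ^ (1 / q.toReal - 1 / p.toReal) : ℝ≥0) * eLpNorm f p μ := by
        gcongr
        exact (hN.bound _ (hf.indicator mB₂)).trans (by gcongr; exact eLpNorm_indicator_le f)
    _ = _ := by rw [ENNReal.coe_add, add_mul]

/-- The constant of the Christ-Kiselev lemma. -/
noncomputable def christKiselevConst (p q : ℝ≥0∞) : ℝ≥0 :=
  (1 - 2 ^ (1 / q.toReal - 1 / p.toReal))⁻¹

/-- Bisection replaces an admissible constant `D` by `C + θ D`, where `θ = 2^(1/q - 1/p) < 1`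
because `p < q`. The iterates converge to the fixed point `C / (1 - θ)`, whatever the number of
sets. The induction runs over all subfamilies because bisection passes to them. -/
theorem IsSublinearBounded.finsetMax_le [LinearOrder ι] (hN : IsSublinearBounded μ ν p q C N)
    (hp : 1 ≤ p) (hpq : p < q) (hq : q ≠ ∞) (hA : ∀ i, MeasurableSet (A i)) (hmono : Monotone A)
    (s : Finset ι) {f : X → ℂ} (hf : MemLp f p μ) :
    eLpNorm (finsetMax N A s f) q ν ≤ (christKiselevConst p q * C : ℝ≥0) * eLpNorm f p μ := by
  set θ : ℝ≥0 := 2 ^ (1 / q.toReal - 1 / p.toReal) with hθ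
  have hP : 0 < p.toReal := ENNReal.toReal_pos (zero_lt_one.trans_le hp).ne' hpq.ne_top
  have hPQ : p.toReal < q.toReal := (ENNReal.toReal_lt_toReal hpq.ne_top hq).2 hpq
  have hθ1 : θ < 1 := by
    refine NNReal.rpow_lt_one_of_one_lt_of_neg (by norm_num) ?_
    rw [sub_neg]
    exact one_div_lt_one_div_of_lt hP hPQ
  have hC : christKiselevConst p q * C = C + christKiselevConst p q * C * θ := by
    have : (1 - θ) * christKiselevConst p q = 1 := mul_inv_cancel₀ (tsub_pos_of_lt hθ1).ne'
    have h2 : christKiselevConst p q = 1 + christKiselevConst p q * θ := by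
      rw [tsub_mul, one_mul] at this
      have h3 : θ * christKiselevConst p q ≤ christKiselevConst p q :=
        mul_le_of_le_one_left' hθ1.le
      rw [← this, mul_comm θ, tsub_add_cancel_of_le (by rwa [mul_comm])]
    calc christKiselevConst p q * C = (1 + christKiselevConst p q * θ) * C := by rw [← h2]
      _ = _ := by ring
  have iter : ∀ k : ℕ, ∀ t ⊆ s, ∀ f, MemLp f p μ → eLpNorm (finsetMax N A t f) q ν
      ≤ (christKiselevConst p q * C + s.card * C * θ ^ k : ℝ≥0) * eLpNorm f p μ := by
    intro k
    induction k with
    | zero =>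
      intro t ht f hf
      refine (hN.finsetMax_le_card (hp.trans hpq.le) hA t hf).trans ?_
      gcongr
      rw [pow_zero, mul_one]
      refine le_trans ?_ le_add_self
      gcongr
    | succ k ih =>
      intro t ht f hf
      refine (hN.finsetMax_improve hp hpq.le hq hA hmono t (fun t' ht' => ih t' (ht'.trans ht))
        hf).trans_eq ?_
      congr 2
      rw [← hθ]
      calc C + (christKiselevConst p q * C + s.card * C * θ ^ k) * θ
          = (C + christKiselevConst p q * C * θ) + s.card * C * θ ^ (k + 1) := by ring
        _ = _ := by rw [← hC]
  have lim : Tendsto (fun k : ℕ => ((christKiselevConst p q * C + s.card * C * θ ^ k : ℝ≥0) : ℝ≥0∞)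
      * eLpNorm f p μ) atTop
      (𝓝 ((christKiselevConst p q * C + s.card * C * 0 : ℝ≥0) * eLpNorm f p μ)) := by
    refine ENNReal.Tendsto.mul_const (ENNReal.tendsto_coe.2 ?_) (Or.inr hf.eLpNorm_ne_top)
    exact ((NNReal.tendsto_pow_atTop_nhds_zero_of_lt_one hθ1).const_mul _).const_add _
  rw [mul_zero, add_zero] at lim
  exact ge_of_tendsto' lim fun k => iter k s subset_rfl f hf

/-- The Christ-Kiselev lemma for sublinear operators and countable chains of sets. -/
theorem IsSublinearBounded.iSup_indicator [LinearOrder ι] [Countable ι]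
    (hN : IsSublinearBounded μ ν p q C N) (hp : 1 ≤ p) (hpq : p < q) (hq : q ≠ ∞)
    (hA : ∀ i, MeasurableSet (A i)) (hmono : Monotone A) :
    IsSublinearBounded μ ν p q (christKiselevConst p q * C)
      fun f y => ⨆ i, N ((A i).indicator f) y where
  measurable f hf := Measurable.iSup fun i => hN.measurable _ (hf.indicator (hA i))
  add_le f g hf hg y := by
    refine iSup_le fun i => ?_
    rw [Set.indicator_add']
    refine (hN.add_le _ _ (hf.indicator (hA i)) (hg.indicator (hA i)) y).trans ?_
    exact add_le_add (le_iSup (fun i => N ((A i).indicator f) y) i)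
      (le_iSup (fun i => N ((A i).indicator g) y) i)
  bound f hf := by
    have hq0 : q ≠ 0 := (zero_le.trans_lt hpq).ne'
    have hQ : 0 < q.toReal := ENNReal.toReal_pos hq0 hq
    have h1 : ∀ y, (⨆ i, N ((A i).indicator f) y) = ⨆ s : Finset ι, finsetMax N A s f y :=
      fun y => iSup_eq_iSup_finset _
    rw [← ENNReal.rpow_le_rpow_iff hQ, eLpNorm_rpow_eq_lintegral hq0 hq]
    have h2 : ∀ y, ‖⨆ i, N ((A i).indicator f) y‖ₑ ^ q.toReal
        = ⨆ s : Finset ι, finsetMax N A s f y ^ q.toReal := by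
      intro y
      rw [enorm_eq_self, h1]
      exact (ENNReal.orderIsoRpow q.toReal hQ).map_iSup _
    simp_rw [h2]
    -- The maxima over finite subfamilies form a directed family, so monotone convergence carries
    -- the uniform bound to the countable supremum.
    rw [lintegral_iSup_directed
      (fun s => ((hN.measurable_finsetMax hA s hf).pow_const _).aemeasurable)]
    · refine iSup_le fun s => ?_
      have := ENNReal.rpow_le_rpow (hN.finsetMax_le hp hpq hq hA hmono s hf) hQ.le
      rwa [eLpNorm_rpow_eq_lintegral hq0 hq] at this
    · refine Monotone.directed_le fun s t hst y => ?_
      exact ENNReal.rpow_le_rpow (biSup_mono fun i hi => hst hi) hQ.le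

end ChristKiselev

end FourierRestriction

namespace FourierRestriction

/-! ### Fourier integrals, and extension of the a priori estimate beyond Schwartz functions. -/

section FourierIntegral

variable {V : Type*} [NormedAddCommGroup V] [InnerProductSpace ℝ V] [FiniteDimensional ℝ V]
  [MeasurableSpace V] [BorelSpace V]

theorem continuous_fourier_of_integrable {g : V → ℂ} (hg : Integrable g) : Continuous (𝓕 g) :=
  VectorFourier.fourierIntegral_continuous Real.continuous_fourierChar
    (innerSL ℝ).continuous₂ hg

theorem integrable_fourierChar_smul {g : V → ℂ} (hg : Integrable g) (ξ : V) :
    Integrable fun v => Real.fourierChar (-inner ℝ v ξ) • g v :=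
  (Real.fourierIntegral_convergent_iff ξ).2 hg

theorem fourier_add_of_integrable {f g : V → ℂ} (hf : Integrable f) (hg : Integrable g) (ξ : V) :
    𝓕 (f + g) ξ = 𝓕 f ξ + 𝓕 g ξ := by
  simp only [Real.fourier_eq, Pi.add_apply, smul_add]
  exact integral_add (integrable_fourierChar_smul hf ξ) (integrable_fourierChar_smul hg ξ)

theorem fourier_sub_of_integrable {f g : V → ℂ} (hf : Integrable f) (hg : Integrable g) (ξ : V) :
    𝓕 (f - g) ξ = 𝓕 f ξ - 𝓕 g ξ := by
  simp only [Real.fourier_eq, Pi.sub_apply, smul_sub]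
  exact integral_sub (integrable_fourierChar_smul hf ξ) (integrable_fourierChar_smul hg ξ)

theorem enorm_fourier_le (g : V → ℂ) (ξ : V) : ‖𝓕 g ξ‖ₑ ≤ eLpNorm g 1 volume := by
  rw [Real.fourier_eq, eLpNorm_one_eq_lintegral_enorm]
  refine (enorm_integral_le_lintegral_enorm _).trans_eq (lintegral_congr fun v => ?_)
  rw [← ofReal_norm, ← ofReal_norm, Circle.norm_smul]

theorem tendsto_fourier_of_tendsto_eLpNorm {α : Type*} {l : Filter α} {g : α → V → ℂ} {g₀ : V → ℂ}
    (hg : ∀ n, Integrable (g n)) (hg₀ : Integrable g₀)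
    (h : Tendsto (fun n => eLpNorm (g n - g₀) 1 volume) l (𝓝 0)) (ξ : V) :
    Tendsto (fun n => 𝓕 (g n) ξ) l (𝓝 (𝓕 g₀ ξ)) := by
  rw [tendsto_iff_edist_tendsto_0]
  refine tendsto_of_tendsto_of_tendsto_of_le_of_le tendsto_const_nhds h (fun _ => zero_le)
    fun n => ?_
  dsimp only
  rw [edist_eq_enorm_sub, ← fourier_sub_of_integrable (hg n) hg₀]
  exact enorm_fourier_le _ _

theorem tendsto_fourier_of_dominated {α : Type*} {l : Filter α} [l.IsCountablyGenerated]
    {g : α → V → ℂ} {g₀ : V → ℂ} {G : V → ℝ} (hg : ∀ n, AEStronglyMeasurable (g n) volume)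
    (hG : Integrable G) (hle : ∀ n, ∀ᵐ x, ‖g n x‖ ≤ G x)
    (hlim : ∀ᵐ x, Tendsto (fun n => g n x) l (𝓝 (g₀ x))) (ξ : V) :
    Tendsto (fun n => 𝓕 (g n) ξ) l (𝓝 (𝓕 g₀ ξ)) := by
  simp only [Real.fourier_eq]
  refine tendsto_integral_filter_of_dominated_convergence G (.of_forall fun n => ?_)
    (.of_forall fun n => ?_) hG ?_
  · refine AEStronglyMeasurable.smul (𝕜 := Circle) ?_ (hg n)
    exact Continuous.aestronglyMeasurable (by fun_prop)
  · filter_upwards [hle n] with x hx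
    rwa [Circle.norm_smul]
  · filter_upwards [hlim] with x hx
    exact hx.const_smul _

/-- These cutoffs make `f b_n` integrable for every `f ∈ L^p`, so that `𝓕 (f b_n)` is a continuous
function defined at every point. -/
theorem exists_schwartz_tendsto_one (V : Type*) [NormedAddCommGroup V] [InnerProductSpace ℝ V]
    [FiniteDimensional ℝ V] :
    ∃ b : ℕ → 𝓢(V, ℂ), (∀ n x, ‖b n x‖ ≤ 1) ∧ ∀ x, Tendsto (fun n => b n x) atTop (𝓝 1) := by
  have key : ∀ n : ℕ, ∃ b : 𝓢(V, ℂ), (∀ x, ‖b x‖ ≤ 1) ∧ ∀ x, ‖x‖ ≤ n → b x = 1 := by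
    intro n
    obtain ⟨β, hβ⟩ : ∃ β : ContDiffBump (0 : V), β.rIn = (n : ℝ) + 1 := ⟨{ rIn := (n : ℝ) + 1, rOut := (n : ℝ) + 2, rIn_pos := by positivity, rIn_lt_rOut := by linarith }, rfl⟩
    have h1 : ContDiff ℝ (⊤ : ℕ∞) fun x => (β x : ℂ) :=
      (Complex.ofRealCLM.contDiff (n := (⊤ : ℕ∞))).comp (β.contDiff (n := ⊤))
    have h2 : HasCompactSupport fun x => (β x : ℂ) :=
      HasCompactSupport.comp_left (g := ((↑) : ℝ → ℂ)) β.hasCompactSupport Complex.ofReal_zero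
    refine ⟨h2.toSchwartzMap h1, fun x => ?_, fun x hx => ?_⟩
    · change ‖(β x : ℂ)‖ ≤ 1
      rw [Complex.norm_real, Real.norm_of_nonneg β.nonneg]
      exact β.le_one
    · change (β x : ℂ) = 1
      rw [β.one_of_mem_closedBall, Complex.ofReal_one]
      rw [mem_closedBall_zero_iff]
      exact hx.trans (by linarith)
  choose b hb1 hb2 using key
  refine ⟨b, hb1, fun x => ?_⟩
  refine tendsto_const_nhds.congr' ?_
  filter_upwards [eventually_ge_atTop ⌈‖x‖⌉₊] with n hn
  exact (hb2 n x ((Nat.le_ceil _).trans (by exact_mod_cast hn))).symm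

theorem exists_schwartz_tendsto_Lp {p : ℝ≥0∞} [Fact (1 ≤ p)] (hp : p ≠ ∞)
    (f : Lp ℂ p (volume : Measure V)) :
    ∃ φ : ℕ → 𝓢(V, ℂ), Tendsto (fun n => (φ n).toLp p volume) atTop (𝓝 f) := by
  have h := denseRange_toLpCLM (E := V) (F := ℂ) (μ := volume) hp f
  obtain ⟨u, hu, hlim⟩ := mem_closure_iff_seq_limit.1 h
  choose φ hφ using hu
  have : (fun n => (φ n).toLp p volume) = u := funext hφ
  exact ⟨φ, this ▸ hlim⟩

theorem exists_schwartz_tendsto_eLpNorm {p : ℝ≥0∞} (hp1 : 1 ≤ p) (hp : p ≠ ∞) {g : V → ℂ}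
    (hg : MemLp g p volume) :
    ∃ φ : ℕ → 𝓢(V, ℂ), Tendsto (fun n => eLpNorm (⇑(φ n) - g) p volume) atTop (𝓝 0) := by
  have : Fact (1 ≤ p) := ⟨hp1⟩
  obtain ⟨φ, hφ⟩ := exists_schwartz_tendsto_Lp hp (hg.toLp g)
  refine ⟨φ, ?_⟩
  rw [tendsto_iff_edist_tendsto_0] at hφ
  refine hφ.congr fun n => ?_
  rw [Lp.edist_def]
  refine eLpNorm_congr_ae ?_
  filter_upwards [hg.coeFn_toLp, (φ n).coeFn_toLp p volume] with x h1 h2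
  simp [h1, h2]

theorem integrable_mul_schwartz {p : ℝ≥0∞} (hp1 : 1 ≤ p) {g : V → ℂ} (hg : MemLp g p volume)
    (b : 𝓢(V, ℂ)) : Integrable (g * ⇑b) := by
  have := Fact.mk hp1
  exact hg.integrable_mul (b.memLp (p.conjExponent) volume)

theorem eLpNorm_mul_schwartz_le {p : ℝ≥0∞} (hp1 : 1 ≤ p) {g : V → ℂ} (hg : MemLp g p volume)
    (b : 𝓢(V, ℂ)) :
    eLpNorm (g * ⇑b) 1 volume ≤ eLpNorm g p volume * eLpNorm b p.conjExponent volume := by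
  have := Fact.mk hp1
  have h := eLpNorm_smul_le_mul_eLpNorm (p := p) (q := p.conjExponent) (r := 1)
    (b.memLp p.conjExponent volume).1 hg.1
  rwa [smul_eq_mul] at h

/-- The a priori estimate with a fixed constant. -/
theorem eLpNorm_fourier_mul_schwartz_le {ν : Measure V} {p q : ℝ≥0∞} (hp1 : 1 ≤ p) (hp : p ≠ ∞)
    {C : ℝ≥0} (hC : ∀ φ : 𝓢(V, ℂ), eLpNorm (𝓕 φ : 𝓢(V, ℂ)) q ν ≤ C * eLpNorm φ p volume)
    {g : V → ℂ} (hg : MemLp g p volume) (b : 𝓢(V, ℂ)) (hb : ∀ x, ‖b x‖ ≤ 1) :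
    eLpNorm (𝓕 (g * ⇑b)) q ν ≤ C * eLpNorm g p volume := by
  obtain ⟨φ, hφ⟩ := exists_schwartz_tendsto_eLpNorm hp1 hp hg
  -- After multiplication by `b`, convergence in `L^p` becomes convergence in `L^1` by Hölder, hence
  -- pointwise convergence of the transforms; Fatou then passes the estimate to the limit.
  let ψ : ℕ → 𝓢(V, ℂ) := fun n => smulLeftCLM ℂ b (φ n)
  have hψ : ∀ n, (ψ n : V → ℂ) = ⇑(φ n) * ⇑b := by
    intro n
    ext x
    simp [ψ, smulLeftCLM_apply_apply b.hasTemperateGrowth, mul_comm]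
  have h1 : ∀ ξ, Tendsto (fun n => 𝓕 (ψ n : V → ℂ) ξ) atTop (𝓝 (𝓕 (g * ⇑b) ξ)) := by
    refine tendsto_fourier_of_tendsto_eLpNorm (fun n => (ψ n).integrable)
      (integrable_mul_schwartz hp1 hg b) ?_
    have : Tendsto (fun n => eLpNorm (⇑(φ n) - g) p volume * eLpNorm b p.conjExponent volume)
        atTop (𝓝 0) := by
      simpa using ENNReal.Tendsto.mul_const hφ
        (Or.inr (b.memLp p.conjExponent volume).eLpNorm_ne_top)
    refine tendsto_of_tendsto_of_tendsto_of_le_of_le tendsto_const_nhds this (fun _ => zero_le)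
      fun n => ?_
    dsimp only
    rw [hψ, ← sub_mul]
    exact eLpNorm_mul_schwartz_le hp1 (((φ n).memLp p volume).sub hg) b
  have h2 : Tendsto (fun n => (C : ℝ≥0∞) * (eLpNorm (⇑(φ n) - g) p volume + eLpNorm g p volume))
      atTop (𝓝 (C * eLpNorm g p volume)) := by
    have := (hφ.add_const (eLpNorm g p volume))
    rw [zero_add] at this
    exact ENNReal.Tendsto.const_mul this (Or.inr ENNReal.coe_ne_top)
  calc eLpNorm (𝓕 (g * ⇑b)) q ν
      ≤ liminf (fun n => eLpNorm (𝓕 (ψ n : V → ℂ)) q ν) atTop :=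
        Lp.eLpNorm_lim_le_liminf_eLpNorm
          (fun n => (continuous_fourier_of_integrable (ψ n).integrable).aestronglyMeasurable) _
          (.of_forall h1)
    _ ≤ liminf (fun n => (C : ℝ≥0∞) * (eLpNorm (⇑(φ n) - g) p volume + eLpNorm g p volume))
          atTop := by
        refine liminf_le_liminf (.of_forall fun n => ?_)
        rw [← fourier_coe]
        refine (hC (ψ n)).trans ?_
        gcongr
        calc eLpNorm (ψ n) p volume ≤ eLpNorm (φ n) p volume := by
              refine eLpNorm_mono fun x => ?_
              rw [hψ, Pi.mul_apply, norm_mul]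
              exact mul_le_of_le_one_right (norm_nonneg _) (hb x)
          _ = eLpNorm ((⇑(φ n) - g) + g) p volume := by rw [sub_add_cancel]
          _ ≤ _ := eLpNorm_add_le (((φ n).memLp p volume).sub hg).1 hg.1 hp1
    _ = _ := h2.liminf_eq

/-- Dominated convergence and Fatou remove the cutoff. The interpolation argument applies this to
truncations of Schwartz functions, which are no longer smooth. -/
theorem eLpNorm_fourier_le_of_memLp {ν : Measure V} {p q : ℝ≥0∞} (hp1 : 1 ≤ p) (hp : p ≠ ∞)
    {C : ℝ≥0} (hC : ∀ φ : 𝓢(V, ℂ), eLpNorm (𝓕 φ : 𝓢(V, ℂ)) q ν ≤ C * eLpNorm φ p volume)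
    {g : V → ℂ} (hg : MemLp g p volume) (hg1 : Integrable g) :
    eLpNorm (𝓕 g) q ν ≤ C * eLpNorm g p volume := by
  obtain ⟨b, hb, hlim⟩ := exists_schwartz_tendsto_one V
  have h1 : ∀ ξ, Tendsto (fun n => 𝓕 (g * ⇑(b n)) ξ) atTop (𝓝 (𝓕 g ξ)) := by
    refine tendsto_fourier_of_dominated (G := fun x => ‖g x‖)
      (fun n => (integrable_mul_schwartz hp1 hg (b n)).1) hg1.norm
      (fun n => .of_forall fun x => ?_) (.of_forall fun x => ?_)
    · rw [Pi.mul_apply, norm_mul]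
      exact mul_le_of_le_one_right (norm_nonneg _) (hb n x)
    · simpa using (hlim x).const_mul (g x)
  calc eLpNorm (𝓕 g) q ν
      ≤ liminf (fun n => eLpNorm (𝓕 (g * ⇑(b n))) q ν) atTop :=
        Lp.eLpNorm_lim_le_liminf_eLpNorm
          (fun n => (continuous_fourier_of_integrable
            (integrable_mul_schwartz hp1 hg (b n))).aestronglyMeasurable) _ (.of_forall h1)
    _ ≤ liminf (fun _ : ℕ => C * eLpNorm g p volume) atTop :=
        liminf_le_liminf (.of_forall fun n =>
          eLpNorm_fourier_mul_schwartz_le hp1 hp hC hg (b n) (hb n))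
    _ = _ := by simp

end FourierIntegral

/-! ### Convolution with dilates as multiplication before the Fourier transform. -/

section Convolution

variable {d : ℕ}

theorem fourier_reflectAt (φ : 𝓢(EuclideanSpace ℝ (Fin d), ℂ)) (ξ x : EuclideanSpace ℝ (Fin d)) :
    𝓕 (reflectAt φ ξ) x = Real.fourierChar (-inner ℝ x ξ) • 𝓕⁻ φ x := by
  rw [fourier_coe, fourierInv_coe, Real.fourier_eq, Real.fourierInv_eq, Circle.smul_def,
    ← integral_smul]
  rw [← integral_sub_left_eq_self _ volume ξ]
  refine integral_congr_ae (.of_forall fun v => ?_)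
  simp only [reflectAt_apply, sub_sub_cancel, ← Circle.smul_def, smul_smul, ← AddChar.map_add_eq_mul]
  congr 2
  rw [inner_sub_left, real_inner_comm ξ x]
  ring

/-- The factor `φ̌` makes the product integrable by Hölder, so the distributional convolution is an
ordinary Fourier integral at every point. -/
theorem conv_fourierLp {s : ℝ≥0∞} [Fact (1 ≤ s)]
    (f : Lp ℂ s (volume : Measure (EuclideanSpace ℝ (Fin d))))
    (φ : 𝓢(EuclideanSpace ℝ (Fin d), ℂ)) (ξ : EuclideanSpace ℝ (Fin d)) :
    conv (fourierLp f) φ ξ = 𝓕 (⇑f * ⇑(𝓕⁻ φ : 𝓢(EuclideanSpace ℝ (Fin d), ℂ))) ξ := by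
  rw [conv, fourierLp, TemperedDistribution.fourier_apply, Lp.toTemperedDistribution_apply,
    Real.fourier_eq]
  refine integral_congr_ae (.of_forall fun x => ?_)
  simp only [fourier_reflectAt, Pi.mul_apply, Circle.smul_def, smul_eq_mul]
  ring

theorem map_scaling_volume (r : PosParam d) :
    Measure.map (scaling r) (volume : Measure (EuclideanSpace ℝ (Fin d)))
      = ENNReal.ofReal (∏ j, r.1 j) • volume := by
  have hr : 0 < ∏ j, r.1 j := Finset.prod_pos fun j _ => r.2 j
  have hdet : LinearMap.det ((scaling r : EuclideanSpace ℝ (Fin d) →L[ℝ] EuclideanSpace ℝ (Fin d)) :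
      EuclideanSpace ℝ (Fin d) →ₗ[ℝ] EuclideanSpace ℝ (Fin d)) = (∏ j, r.1 j)⁻¹ := by
    let B := (EuclideanSpace.basisFun (Fin d) ℝ).toBasis
    have : ((scaling r : EuclideanSpace ℝ (Fin d) →L[ℝ] EuclideanSpace ℝ (Fin d)) :
      EuclideanSpace ℝ (Fin d) →ₗ[ℝ] EuclideanSpace ℝ (Fin d))
        = Matrix.toLin B B (Matrix.diagonal fun j => (r.1 j)⁻¹) := by
      refine B.ext fun i => ?_
      rw [Matrix.toLin_self]
      ext j
      simp [B, scaling, Matrix.diagonal_apply, PiLp.single_apply, div_eq_mul_inv]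
      by_cases h : j = i <;> simp [h]
    rw [this, LinearMap.det_toLin, Matrix.det_diagonal, Finset.prod_inv_distrib]
  have := Measure.map_linearMap_addHaar_eq_smul_addHaar
    (volume : Measure (EuclideanSpace ℝ (Fin d))) (f := ((scaling r :
      EuclideanSpace ℝ (Fin d) →L[ℝ] EuclideanSpace ℝ (Fin d)) :
      EuclideanSpace ℝ (Fin d) →ₗ[ℝ] EuclideanSpace ℝ (Fin d))) (by rw [hdet]; positivity)
  rw [hdet, inv_inv, abs_of_pos hr] at this
  exact this

theorem integral_comp_scaling (r : PosParam d) (G : EuclideanSpace ℝ (Fin d) → ℂ) :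
    ∫ x, G (scaling r x) = (∏ j, r.1 j) • ∫ x, G x := by
  have hr : 0 < ∏ j, r.1 j := Finset.prod_pos fun j _ => r.2 j
  have := (scaling r).toHomeomorph.measurableEmbedding.integral_map (μ := volume) G
  rw [show ⇑(scaling r).toHomeomorph = scaling r from rfl, map_scaling_volume,
    integral_smul_measure, ENNReal.toReal_ofReal hr.le] at this
  exact this.symm

theorem scaling_apply (r : PosParam d) (x : EuclideanSpace ℝ (Fin d)) (j : Fin d) :
    scaling r x j = x j / r.1 j := rfl

/-- The normalising factor of the dilate is the Jacobian of the scaling and cancels, leaving the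
fixed function `χ̌` at rescaled coordinates. -/
theorem fourierInv_dilate (χ : 𝓢(EuclideanSpace ℝ (Fin d), ℂ)) (r : PosParam d)
    (x : EuclideanSpace ℝ (Fin d)) :
    𝓕⁻ (dilate χ r) x = 𝓕⁻ χ (WithLp.toLp 2 fun j => r.1 j * x j) := by
  have hr : 0 < ∏ j, r.1 j := Finset.prod_pos fun j _ => r.2 j
  rw [fourierInv_coe, fourierInv_coe, Real.fourierInv_eq, Real.fourierInv_eq]
  have := integral_comp_scaling r fun v =>
    Real.fourierChar (inner ℝ v (WithLp.toLp 2 fun j => r.1 j * x j)) • χ v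
  rw [← inv_smul_eq_iff₀ hr.ne', ← integral_smul] at this
  rw [← this]
  refine integral_congr_ae (.of_forall fun v => ?_)
  dsimp only
  rw [dilate_apply, smul_comm]
  congr 2
  · congr 1
    simp only [PiLp.inner_apply, scaling_apply]
    refine Finset.sum_congr rfl fun j _ => ?_
    have := (r.2 j).ne'
    simp
    field_simp

/-- The supremum is uncountable, but a supremum of continuous functions is lower semicontinuous. -/
theorem measurable_maximalFunction {s : ℝ≥0∞} [Fact (1 ≤ s)]
    (f : Lp ℂ s (volume : Measure (EuclideanSpace ℝ (Fin d))))
    (χ : 𝓢(EuclideanSpace ℝ (Fin d), ℂ)) : Measurable (maximalFunction (fourierLp f) χ) := by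
  refine LowerSemicontinuous.measurable ?_
  refine lowerSemicontinuous_iSup fun r => Continuous.lowerSemicontinuous ?_
  simp only [conv_fourierLp]
  exact (continuous_fourier_of_integrable
    (integrable_mul_schwartz Fact.out (Lp.memLp f) _)).enorm

end Convolution

end FourierRestriction

namespace FourierRestriction

/-! ### Schwartz functions as superpositions of octant indicators. -/

section MixedDerivative

open LineDeriv

/-- Used to freeze one coordinate and to restrict to a line. The lower bound on `L` is what
preserves decay. -/
theorem exists_schwartz_comp_affine {D W : Type*} [NormedAddCommGroup D] [NormedSpace ℝ D]
    [NormedAddCommGroup W] [NormedSpace ℝ W] (L : D →L[ℝ] W) (hL : ∀ x, ‖x‖ ≤ ‖L x‖) (c : W)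
    (ψ : 𝓢(W, ℂ)) : ∃ φ : 𝓢(D, ℂ), ∀ x, φ x = ψ (c + L x) := by
  have hg : (fun x => c + L x).HasTemperateGrowth := by fun_prop
  have ha : AntilipschitzWith 1 fun x => c + L x := by
    refine AntilipschitzWith.of_le_mul_dist fun x y => ?_
    simpa [dist_eq_norm] using hL (x - y)
  exact ⟨compCLMOfAntilipschitz ℝ hg ha ψ, fun x => rfl⟩

variable {D W : Type*} [NormedAddCommGroup D] [NormedSpace ℝ D]
    [NormedAddCommGroup W] [NormedSpace ℝ W]

theorem lineDerivOp_comp_affine {L : D →L[ℝ] W} {c : W} {ψ : 𝓢(W, ℂ)} {φ : 𝓢(D, ℂ)}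
    (h : ∀ x, φ x = ψ (c + L x)) (v : D) (x : D) : ∂_{v} φ x = ∂_{L v} ψ (c + L x) := by
  rw [lineDerivOp_apply_eq_fderiv, lineDerivOp_apply_eq_fderiv]
  have h1 : HasFDerivAt (fun x => ψ (c + L x)) ((fderiv ℝ ψ (c + L x)).comp L) x :=
    (ψ.hasFDerivAt (c + L x)).comp x (L.hasFDerivAt.const_add c)
  rw [← funext h] at h1
  rw [h1.fderiv]
  rfl

theorem iteratedLineDerivOp_comp_affine {L : D →L[ℝ] W} {c : W} {ψ : 𝓢(W, ℂ)} {φ : 𝓢(D, ℂ)}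
    (h : ∀ x, φ x = ψ (c + L x)) {k : ℕ} (m : Fin k → D) (x : D) :
    ∂^{m} φ x = ∂^{fun i => L (m i)} ψ (c + L x) := by
  induction k generalizing x with
  | zero => simpa using h x
  | succ k ih =>
    rw [iteratedLineDerivOp_succ_left, iteratedLineDerivOp_succ_left]
    exact lineDerivOp_comp_affine (fun x => ih (Fin.tail m) x) (m 0) x

theorem integral_Ioi_lineDerivOp (φ : 𝓢(ℝ, ℂ)) (a : ℝ) :
    ∫ t in Set.Ioi a, ∂_{(1 : ℝ)} φ t = -φ a := by
  rw [integral_Ioi_of_hasDerivAt_of_tendsto' (f := φ) (m := 0), zero_sub]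
  · intro t _
    rw [lineDerivOp_apply_eq_fderiv, fderiv_apply_one_eq_deriv]
    exact φ.hasDerivAt t
  · exact (∂_{(1 : ℝ)} φ).integrable.integrableOn
  · exact φ.tendsto_cocompact.mono_left atTop_le_cocompact

/-- The mixed derivative `∂_1 ⋯ ∂_n`. -/
noncomputable def mixedDeriv (n : ℕ) (ψ : 𝓢(Fin n → ℝ, ℂ)) : 𝓢(Fin n → ℝ, ℂ) :=
  ∂^{fun j : Fin n => (Pi.single j 1 : Fin n → ℝ)} ψ

/-- A Schwartz function is recovered from its mixed derivative by integrating over an octant. -/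
theorem eq_integral_mixedDeriv (n : ℕ) (ψ : 𝓢(Fin n → ℝ, ℂ)) (y : Fin n → ℝ) :
    ψ y = (-1) ^ n * ∫ t, {t | ∀ j, y j < t j}.indicator (mixedDeriv n ψ) t := by
  induction n with
  | zero =>
    simp [integral_unique, Measure.real, volume_pi, mixedDeriv]
    congr 1
    exact Subsingleton.elim _ _
  | succ n ih =>
    set m : Fin (n + 1) → Fin (n + 1) → ℝ := fun j => Pi.single j 1 with hm
    set Φ := ∂^{Fin.tail m} ψ with hΦ
    have hsucc : mixedDeriv (n + 1) ψ = ∂_{m 0} Φ := iteratedLineDerivOp_succ_left m ψ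
    let L : (Fin n → ℝ) →L[ℝ] (Fin (n + 1) → ℝ) :=
      ContinuousLinearMap.pi (Fin.cons 0 fun j => ContinuousLinearMap.proj j)
    have hLsucc : ∀ x j, L x (Fin.succ j) = x j := fun x j => by simp [L]
    have hL0 : ∀ x, L x 0 = 0 := fun x => by simp [L]
    let K : ℝ →L[ℝ] (Fin (n + 1) → ℝ) := ContinuousLinearMap.toSpanSingleton ℝ (m 0)
    have hcons : ∀ t x, (Fin.cons t x : Fin (n + 1) → ℝ) = m 0 * (fun _ => t) + L x := by
      intro t x
      ext j
      refine Fin.cases ?_ (fun j => ?_) j <;> simp [hm, hL0, hLsucc]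
    have hcons' : ∀ t x, (Fin.cons t x : Fin (n + 1) → ℝ) = L x + K t := by
      intro t x
      ext j
      refine Fin.cases ?_ (fun j => ?_) j <;> simp [hm, hL0, hLsucc, K]
    -- `φ` is the slice of `ψ` with first coordinate frozen at `y 0`: the product `m 0 * fun _ => t`
    -- is `t` times the first basis vector.
    obtain ⟨φ, hφ⟩ := exists_schwartz_comp_affine L (fun x => by
      refine (pi_norm_le_iff_of_nonneg (norm_nonneg _)).2 fun j => ?_
      rw [← hLsucc x j]
      exact norm_le_pi_norm _ _) (m 0 * fun _ => y 0) ψ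
    have hφΦ : ∀ x, mixedDeriv n φ x = Φ (Fin.cons (y 0) x) := by
      intro x
      rw [mixedDeriv, iteratedLineDerivOp_comp_affine hφ, hcons, hΦ]
      congr 3
      ext j i
      refine Fin.cases ?_ (fun i => ?_) i
      · simp [hL0, hm, Fin.tail]
      · simp [hLsucc, hm, Fin.tail, Pi.single_apply]
    -- This is the fundamental theorem of calculus along the first coordinate; the remaining
    -- derivatives are already contained in `Φ`.
    have inner : ∀ x, ∫ t in Set.Ioi (y 0), (mixedDeriv (n + 1) ψ) (Fin.cons t x) = -Φ (Fin.cons (y 0) x) := by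
      intro x
      obtain ⟨ρ, hρ⟩ := exists_schwartz_comp_affine K (fun t => by
        calc ‖t‖ = ‖K t 0‖ := by simp [K, hm]
          _ ≤ _ := norm_le_pi_norm _ _) (L x) Φ
      rw [hcons', ← hρ, ← integral_Ioi_lineDerivOp]
      refine integral_congr_ae (.of_forall fun t => ?_)
      dsimp only
      rw [hsucc, hcons', lineDerivOp_comp_affine hρ]
      simp [K]
    set B := {t : Fin (n + 1) → ℝ | ∀ j, y j < t j} with hB
    have mB : MeasurableSet B := by
      rw [hB, Set.ofPred_forall]
      exact MeasurableSet.iInter fun j => measurableSet_lt measurable_const (measurable_pi_apply j)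
    let e := MeasurableEquiv.piFinSuccAbove (fun _ : Fin (n + 1) => ℝ) 0
    have he : MeasurePreserving e.symm :=
      (volume_preserving_piFinSuccAbove (fun _ : Fin (n + 1) => ℝ) 0).symm _
    have hint : Integrable (B.indicator (mixedDeriv (n + 1) ψ)) := (mixedDeriv (n + 1) ψ).integrable.indicator mB
    have hes : ∀ p : ℝ × (Fin n → ℝ), e.symm p = Fin.cons p.1 p.2 := fun p => by
      simp only [e, MeasurableEquiv.piFinSuccAbove]
      ext j
      refine Fin.cases ?_ (fun j => ?_) j <;> simp
    rw [← he.integral_comp', Measure.volume_eq_prod, integral_prod_symm]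
    swap
    · exact (he.integrable_comp_emb e.symm.measurableEmbedding).2 hint
    -- The octant is a product, so by Fubini the inner integral over the first coordinate leaves the
    -- mixed derivative of the slice, to which the induction hypothesis applies.
    have hsplit : ∀ x : Fin n → ℝ, ∫ t, B.indicator (mixedDeriv (n + 1) ψ) (e.symm (t, x))
        = -{x : Fin n → ℝ | ∀ j, y j.succ < x j}.indicator (mixedDeriv n φ) x := by
      intro x
      by_cases hx : x ∈ {x : Fin n → ℝ | ∀ j, y j.succ < x j}
      · rw [Set.indicator_of_mem hx, hφΦ, ← inner, ← integral_indicator measurableSet_Ioi]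
        refine integral_congr_ae (.of_forall fun t => ?_)
        dsimp only
        rw [hes]
        by_cases ht : y 0 < t
        · rw [Set.indicator_of_mem, Set.indicator_of_mem (Set.mem_Ioi.2 ht)]
          exact fun j => Fin.cases (by simpa using ht) (fun j => by simpa using hx j) j
        · rw [Set.indicator_of_notMem, Set.indicator_of_notMem (by simpa using ht)]
          exact fun h => ht (by simpa using h 0)
      · rw [Set.indicator_of_notMem hx, neg_zero]
        refine integral_eq_zero_of_ae (.of_forall fun t => ?_)
        dsimp only
        rw [hes, Set.indicator_of_notMem]
        · rfl
        · exact fun h => hx fun j => by simpa using h j.succ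
    simp_rw [hsplit]
    rw [integral_neg, pow_succ, mul_assoc, neg_one_mul, neg_neg, ← ih φ (fun j => y j.succ), hφ,
      ← hcons]
    congr 1
    exact (Fin.cons_self_tail y).symm

/-- The density is the mixed derivative up to sign, and it is integrable because it is Schwartz. For
fixed `t` the integrand is the indicator of an octant in `y`. -/
theorem exists_integral_octant {d : ℕ} (ψ : 𝓢(EuclideanSpace ℝ (Fin d), ℂ)) :
    ∃ g : (Fin d → ℝ) → ℂ, Integrable g ∧ ∀ y : EuclideanSpace ℝ (Fin d),
      ψ y = ∫ t, {t | ∀ j, y j < t j}.indicator g t := by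
  let ψ' : 𝓢(Fin d → ℝ, ℂ) :=
    compCLMOfContinuousLinearEquiv ℂ (EuclideanSpace.equiv (Fin d) ℝ).symm ψ
  refine ⟨fun t => (-1) ^ d * mixedDeriv d ψ' t,
    (SchwartzMap.integrable _).const_mul _, fun y => ?_⟩
  have h := eq_integral_mixedDeriv d ψ' (fun j => y j)
  rw [← integral_const_mul] at h
  refine Eq.trans ?_ (h.trans (integral_congr_ae (.of_forall fun t => ?_)))
  · rfl
  · simp only [Set.indicator_apply]
    split_ifs <;> simp

end MixedDerivative

end FourierRestriction

namespace FourierRestriction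

/-! ### The multi-parameter maximal estimate. -/

section Maximal

variable {d : ℕ}

theorem eLpNorm_le_liminf_eLpNorm {Y : Type*} [MeasurableSpace Y] {ν : Measure Y} {q : ℝ≥0∞}
    (hq0 : q ≠ 0) (hq : q ≠ ∞) {h : ℕ → Y → ℝ≥0∞} (hm : ∀ n, Measurable (h n)) {H : Y → ℝ≥0∞}
    (hH : ∀ᵐ y ∂ν, H y ≤ liminf (fun n => h n y) atTop) :
    eLpNorm H q ν ≤ liminf (fun n => eLpNorm (h n) q ν) atTop := by
  have hQ : 0 < q.toReal := ENNReal.toReal_pos hq0 hq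
  rw [← ENNReal.rpow_le_rpow_iff hQ, eLpNorm_rpow_eq_lintegral hq0 hq]
  calc ∫⁻ y, ‖H y‖ₑ ^ q.toReal ∂ν
      ≤ ∫⁻ y, liminf (fun n => h n y ^ q.toReal) atTop ∂ν := by
        refine lintegral_mono_ae ?_
        filter_upwards [hH] with y hy
        rw [enorm_eq_self]
        refine (ENNReal.rpow_le_rpow hy hQ.le).trans_eq ?_
        exact (ENNReal.orderIsoRpow q.toReal hQ).liminf_apply
    _ ≤ liminf (fun n => ∫⁻ y, h n y ^ q.toReal ∂ν) atTop :=
        lintegral_liminf_le fun n => (hm n).pow_const _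
    _ = liminf (fun n => eLpNorm (h n) q ν ^ q.toReal) atTop := by
        simp only [eLpNorm_rpow_eq_lintegral hq0 hq, enorm_eq_self]
    _ = (liminf (fun n => eLpNorm (h n) q ν) atTop) ^ q.toReal :=
        ((ENNReal.orderIsoRpow q.toReal hQ).liminf_apply).symm

theorem eLpNorm_le_of_le_liminf {Y : Type*} [MeasurableSpace Y] {ν : Measure Y} {q : ℝ≥0∞}
    (hq0 : q ≠ 0) (hq : q ≠ ∞) {h : ℕ → Y → ℝ≥0∞} (hm : ∀ n, Measurable (h n)) {H : Y → ℝ≥0∞}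
    (hH : ∀ᵐ y ∂ν, H y ≤ liminf (fun n => h n y) atTop) {B : ℝ≥0∞}
    (hB : ∀ n, eLpNorm (h n) q ν ≤ B) : eLpNorm H q ν ≤ B := by
  refine (eLpNorm_le_liminf_eLpNorm hq0 hq hm hH).trans ?_
  exact (liminf_le_liminf (v := fun _ => B) (.of_forall hB)).trans_eq (by simp)

theorem eLpNorm_const_mul_ennreal {Y : Type*} [MeasurableSpace Y] {ν : Measure Y} {q : ℝ≥0∞}
    (hq0 : q ≠ 0) (hq : q ≠ ∞) {c : ℝ≥0∞} (hc : c ≠ ∞) (h : Y → ℝ≥0∞) :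
    eLpNorm (fun y => c * h y) q ν = c * eLpNorm h q ν := by
  have hQ : 0 < q.toReal := ENNReal.toReal_pos hq0 hq
  refine (ENNReal.rpow_left_injective hQ.ne') ?_
  simp only [ENNReal.mul_rpow_of_nonneg _ _ hQ.le, eLpNorm_rpow_eq_lintegral hq0 hq, enorm_eq_self]
  exact lintegral_const_mul' _ _ (ENNReal.rpow_ne_top_of_nonneg hQ.le hc)

/-- The set of points all of whose coordinates are smaller than those of `u`. -/
def octant (u : Fin d → ℝ) : Set (EuclideanSpace ℝ (Fin d)) := {x | ∀ j, x j < u j}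

theorem measurableSet_octant (u : Fin d → ℝ) : MeasurableSet (octant u) := by
  rw [octant, Set.ofPred_forall]
  exact MeasurableSet.iInter fun j => measurableSet_lt (by fun_prop) measurable_const

/-- For each coordinate the half-spaces `{x_i < v}`, `v ∈ ℚ`, form a countable chain. Each further
coordinate applies Christ-Kiselev to the maximal operator already built, which is sublinear but not
linear, and costs one more factor. -/
theorem IsSublinearBounded.exists_octant_majorant {Y : Type*} [MeasurableSpace Y] {ν : Measure Y}
    {p q : ℝ≥0∞} {C : ℝ≥0} {N : (EuclideanSpace ℝ (Fin d) → ℂ) → Y → ℝ≥0∞}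
    (hN : IsSublinearBounded volume ν p q C N) (hp : 1 ≤ p) (hpq : p < q) (hq : q ≠ ∞) :
    ∃ N', IsSublinearBounded volume ν p q (christKiselevConst p q ^ d * C) N' ∧
      ∀ (u : Fin d → ℚ) f y, N ((octant fun j => (u j : ℝ)).indicator f) y ≤ N' f y := by
  suffices h : ∀ J : Finset (Fin d), ∃ N',
      IsSublinearBounded volume ν p q (christKiselevConst p q ^ J.card * C) N' ∧
      ∀ (u : Fin d → ℚ) f y,
        N ({x : EuclideanSpace ℝ (Fin d) | ∀ j ∈ J, x j < u j}.indicator f) y ≤ N' f y by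
    obtain ⟨N', h1, h2⟩ := h Finset.univ
    exact ⟨N', by simpa using h1, by simpa [octant] using h2⟩
  intro J
  induction J using Finset.induction_on with
  | empty => exact ⟨N, by simpa using hN, by simp⟩
  | insert i J hi ih =>
    obtain ⟨N', h1, h2⟩ := ih
    refine ⟨fun f y => ⨆ v : ℚ, N' ({x : EuclideanSpace ℝ (Fin d) | x i < v}.indicator f) y, ?_, ?_⟩
    · have := h1.iSup_indicator hp hpq hq
        (A := fun v : ℚ => {x : EuclideanSpace ℝ (Fin d) | x i < v})
        (fun v => measurableSet_lt (by fun_prop) measurable_const)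
        (fun v w hvw x (hx : x i < v) => hx.trans_le (Rat.cast_le.2 hvw))
      rw [← mul_assoc, ← pow_succ', ← Finset.card_insert_of_notMem hi] at this
      exact this
    · intro u f y
      have : {x : EuclideanSpace ℝ (Fin d) | ∀ j ∈ insert i J, x j < u j}.indicator f
          = {x : EuclideanSpace ℝ (Fin d) | ∀ j ∈ J, x j < u j}.indicator
            ({x : EuclideanSpace ℝ (Fin d) | x i < u i}.indicator f) := by
        rw [Set.indicator_indicator]
        congr 1
        ext x
        simp [and_comm]
      rw [this]
      exact (h2 u _ y).trans
        (le_iSup (fun v : ℚ => N' ({x : EuclideanSpace ℝ (Fin d) | x i < v}.indicator f) y) (u i))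

/-- The inequalities defining an octant are strict, so octants with rational corners approaching `v`
from below converge to it at every point. This reduces the supremum to a countable one. -/
theorem enorm_fourier_indicator_octant_le {F : EuclideanSpace ℝ (Fin d) → ℂ} (hF : Integrable F)
    (v : Fin d → ℝ) (ξ : EuclideanSpace ℝ (Fin d)) :
    ‖𝓕 ((octant v).indicator F) ξ‖ₑ
      ≤ ⨆ u : Fin d → ℚ, ‖𝓕 ((octant fun j => (u j : ℝ)).indicator F) ξ‖ₑ := by
  have : ∀ (n : ℕ) (j : Fin d), ∃ a : ℚ, v j - 1 / ((n : ℝ) + 1) < a ∧ (a : ℝ) < v j :=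
    fun n j => exists_rat_btwn (sub_lt_self _ (by positivity))
  choose u hu1 hu2 using this
  have h : Tendsto (fun n => 𝓕 ((octant fun j => (u n j : ℝ)).indicator F) ξ) atTop
      (𝓝 (𝓕 ((octant v).indicator F) ξ)) := by
    refine tendsto_fourier_of_dominated (G := fun x => ‖F x‖)
      (fun n => (hF.indicator (measurableSet_octant _)).1) hF.norm
      (fun n => .of_forall fun x => norm_indicator_le_norm_self _ _) (.of_forall fun x => ?_) ξ
    by_cases hx : x ∈ octant v
    · rw [Set.indicator_of_mem hx]
      refine tendsto_const_nhds.congr' ?_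
      have : ∀ᶠ n : ℕ in atTop, ∀ j, x j < v j - 1 / ((n : ℝ) + 1) := by
        refine eventually_all.2 fun j => ?_
        have h1 : Tendsto (fun n : ℕ => v j - 1 / ((n : ℝ) + 1)) atTop (𝓝 (v j - 0)) :=
          tendsto_one_div_add_atTop_nhds_zero_nat.const_sub _
        rw [sub_zero] at h1
        exact h1.eventually_const_lt (hx j)
      filter_upwards [this] with n hn
      rw [Set.indicator_of_mem]
      exact fun j => (hn j).trans (hu1 n j)
    · rw [Set.indicator_of_notMem hx]
      refine tendsto_const_nhds.congr fun n => ?_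
      rw [Set.indicator_of_notMem]
      exact fun h => hx fun j => (h j).trans (hu2 n j)
  exact le_of_tendsto' h.enorm fun n =>
    le_iSup (fun u : Fin d → ℚ => ‖𝓕 ((octant fun j => (u j : ℝ)).indicator F) ξ‖ₑ) (u n)

/-- Insert the octant representation of `ψ` and use Fubini. The condition `r_j x_j < t_j` reads `x_j
< t_j / r_j`, again an octant, so the bound does not depend on `r`. -/
theorem enorm_fourier_mul_dilate_le {F : EuclideanSpace ℝ (Fin d) → ℂ} (hF : Integrable F)
    {ψ : EuclideanSpace ℝ (Fin d) → ℂ} {g : (Fin d → ℝ) → ℂ} (hg : Integrable g)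
    (hψ : ∀ y : EuclideanSpace ℝ (Fin d), ψ y = ∫ t, {t | ∀ j, y j < t j}.indicator g t)
    (r : PosParam d) (ξ : EuclideanSpace ℝ (Fin d)) :
    ‖𝓕 (fun x => F x * ψ (WithLp.toLp 2 fun j => r.1 j * x j)) ξ‖ₑ
      ≤ (∫⁻ t, ‖g t‖ₑ) * ⨆ u : Fin d → ℚ, ‖𝓕 ((octant fun j => (u j : ℝ)).indicator F) ξ‖ₑ := by
  set H : EuclideanSpace ℝ (Fin d) → ℂ := fun x => Real.fourierChar (-inner ℝ x ξ) • F x with hH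
  have hHint : Integrable H := integrable_fourierChar_smul hF ξ
  set A : Set (EuclideanSpace ℝ (Fin d) × (Fin d → ℝ)) := {z | ∀ j, r.1 j * z.1 j < z.2 j}
  have mA : MeasurableSet A := by
    simp only [A, Set.ofPred_forall]
    exact MeasurableSet.iInter fun j => measurableSet_lt (by fun_prop) (by fun_prop)
  have hint : Integrable (Function.uncurry fun x t => A.indicator (fun z => H z.1 * g z.2) (x, t))
      (volume.prod volume) := (hHint.mul_prod hg).indicator mA
  have e1 : 𝓕 (fun x => F x * ψ (WithLp.toLp 2 fun j => r.1 j * x j)) ξ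
      = ∫ t, g t * 𝓕 ((octant fun j => t j / r.1 j).indicator F) ξ := by
    rw [Real.fourier_eq]
    calc _ = ∫ x, ∫ t, A.indicator (fun z => H z.1 * g z.2) (x, t) := by
          refine integral_congr_ae (.of_forall fun x => ?_)
          dsimp only
          rw [hψ, ← smul_mul_assoc, ← integral_const_mul]
          refine integral_congr_ae (.of_forall fun t => ?_)
          simp only [Set.indicator_apply, A, Set.mem_ofPred_eq]
          split_ifs <;> simp [hH]
      _ = ∫ t, ∫ x, A.indicator (fun z => H z.1 * g z.2) (x, t) := integral_integral_swap hint
      _ = _ := by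
          refine integral_congr_ae (.of_forall fun t => ?_)
          dsimp only
          rw [Real.fourier_eq, ← integral_const_mul]
          refine integral_congr_ae (.of_forall fun x => ?_)
          have : (x, t) ∈ A ↔ x ∈ octant fun j => t j / r.1 j :=
            forall_congr' fun j => by rw [lt_div_iff₀' (r.2 j)]
          dsimp only
          by_cases h : (x, t) ∈ A
          · rw [Set.indicator_of_mem h, Set.indicator_of_mem (this.1 h)]
            simp [hH, mul_comm]
          · rw [Set.indicator_of_notMem h, Set.indicator_of_notMem (fun h' => h (this.2 h'))]
            simp
  rw [e1]
  calc _ ≤ ∫⁻ t, ‖g t * 𝓕 ((octant fun j => t j / r.1 j).indicator F) ξ‖ₑ :=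
        enorm_integral_le_lintegral_enorm _
    _ ≤ ∫⁻ t, ‖g t‖ₑ * ⨆ u : Fin d → ℚ, ‖𝓕 ((octant fun j => (u j : ℝ)).indicator F) ξ‖ₑ := by
        refine lintegral_mono fun t => ?_
        rw [enorm_mul]
        gcongr
        exact enorm_fourier_indicator_octant_le hF _ ξ
    _ = _ := lintegral_mul_const'' _ hg.1.enorm

/-- Thanks to the cutoff, subadditivity holds at every point, and the constant does not depend on
`b`. -/
theorem isSublinearBounded_fourier_mul {ν : Measure (EuclideanSpace ℝ (Fin d))} {p q : ℝ≥0∞}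
    (hp1 : 1 ≤ p) (hp : p ≠ ∞) {C : ℝ≥0}
    (hC : ∀ φ : 𝓢(EuclideanSpace ℝ (Fin d), ℂ),
      eLpNorm (𝓕 φ : 𝓢(EuclideanSpace ℝ (Fin d), ℂ)) q ν ≤ C * eLpNorm φ p volume)
    (b : 𝓢(EuclideanSpace ℝ (Fin d), ℂ)) (hb : ∀ x, ‖b x‖ ≤ 1) :
    IsSublinearBounded volume ν p q C fun f ξ =>
      ‖𝓕 (f * ⇑b : EuclideanSpace ℝ (Fin d) → ℂ) ξ‖ₑ where
  measurable f hf :=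
    (continuous_fourier_of_integrable (integrable_mul_schwartz hp1 hf b)).enorm.measurable
  add_le f g hf hg ξ := by
    rw [add_mul, fourier_add_of_integrable (integrable_mul_schwartz hp1 hf b)
      (integrable_mul_schwartz hp1 hg b)]
    exact enorm_add_le _ _
  bound f hf := by
    rw [eLpNorm_enorm]
    exact eLpNorm_fourier_mul_schwartz_le hp1 hp hC hf b hb

/-- The octant majorants `N n` depend on the cutoff `b n`, but their bounds do not; Fatou removes
the cutoff at the end. -/
theorem exists_eLpNorm_maximalFunction_le {ν : Measure (EuclideanSpace ℝ (Fin d))} {p q : ℝ≥0∞}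
    [Fact (1 ≤ p)] (hpq : p < q) (hq : q ≠ ∞) (hest : APrioriEstimate ν p q)
    (χ : 𝓢(EuclideanSpace ℝ (Fin d), ℂ)) :
    ∃ C : ℝ≥0, ∀ f : Lp ℂ p (volume : Measure (EuclideanSpace ℝ (Fin d))),
      eLpNorm (maximalFunction (fourierLp f) χ) q ν ≤ C * eLpNorm f p volume := by
  obtain ⟨C, hC⟩ := hest
  have hp1 : 1 ≤ p := Fact.out
  obtain ⟨g, hg, hψ⟩ := exists_integral_octant (𝓕⁻ χ)
  obtain ⟨b, hb, hlim⟩ := exists_schwartz_tendsto_one (EuclideanSpace ℝ (Fin d))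
  have hgtop : ∫⁻ t, ‖g t‖ₑ ≠ ∞ := hg.2.ne
  choose N hN hNle using fun n =>
    (isSublinearBounded_fourier_mul hp1 hpq.ne_top hC (b n) (hb n)).exists_octant_majorant
      hp1 hpq hq
  refine ⟨(∫⁻ t, ‖g t‖ₑ).toNNReal * (christKiselevConst p q ^ d * C), fun f => ?_⟩
  have hf := Lp.memLp f
  refine eLpNorm_le_of_le_liminf (zero_le.trans_lt hpq).ne' hq
    (h := fun n y => (∫⁻ t, ‖g t‖ₑ) * N n f y)
    (fun n => ((hN n).measurable f hf).const_mul _) (.of_forall fun ξ => ?_) fun n => ?_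
  · refine iSup_le fun r => ?_
    rw [conv_fourierLp]
    have h1 : Tendsto (fun n => ‖𝓕 (fun x => (f x * b n x)
        * (𝓕⁻ χ) (WithLp.toLp 2 fun j => r.1 j * x j)) ξ‖ₑ) atTop
        (𝓝 ‖𝓕 (⇑f * ⇑(𝓕⁻ (dilate χ r) : 𝓢(EuclideanSpace ℝ (Fin d), ℂ))) ξ‖ₑ) := by
      have h2 := integrable_mul_schwartz hp1 hf (𝓕⁻ (dilate χ r))
      have h3 : ∀ n, (fun x => (f x * b n x) * (𝓕⁻ χ) (WithLp.toLp 2 fun j => r.1 j * x j))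
          = fun x => (⇑f * ⇑(𝓕⁻ (dilate χ r) : 𝓢(EuclideanSpace ℝ (Fin d), ℂ))) x * b n x := by
        intro n
        ext x
        rw [Pi.mul_apply, fourierInv_dilate]
        ring
      refine (tendsto_fourier_of_dominated (fun n => ?_) h2.norm (fun n => .of_forall fun x => ?_)
        (.of_forall fun x => ?_) ξ).enorm
      · rw [h3]
        exact h2.1.mul (b n).continuous.aestronglyMeasurable
      · rw [congrFun (h3 n) x, norm_mul]
        exact mul_le_of_le_one_right (norm_nonneg _) (hb n x)
      · refine Tendsto.congr (fun n => (congrFun (h3 n) x).symm) ?_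
        simpa using (hlim x).const_mul
          ((⇑f * ⇑(𝓕⁻ (dilate χ r) : 𝓢(EuclideanSpace ℝ (Fin d), ℂ))) x)
    rw [← h1.liminf_eq]
    refine liminf_le_liminf (.of_forall fun n => ?_)
    refine (enorm_fourier_mul_dilate_le (integrable_mul_schwartz hp1 hf (b n)) hg hψ r ξ).trans ?_
    gcongr
    refine iSup_le fun u => le_trans (le_of_eq ?_) (hNle n u f ξ)
    refine congrArg (fun h : EuclideanSpace ℝ (Fin d) → ℂ => ‖𝓕 h ξ‖ₑ) (funext fun x => ?_)
    by_cases h : x ∈ octant fun j => (u j : ℝ) <;> simp [h]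
  · calc eLpNorm (fun y => (∫⁻ t, ‖g t‖ₑ) * N n f y) q ν
        = (∫⁻ t, ‖g t‖ₑ) * eLpNorm (N n f) q ν := by
          exact eLpNorm_const_mul_ennreal (zero_le.trans_lt hpq).ne' hq hgtop _
      _ ≤ _ := by
          rw [ENNReal.coe_mul, ENNReal.coe_toNNReal hgtop, mul_assoc]
          gcongr
          exact (hN n).bound f hf

end Maximal

end FourierRestriction

namespace FourierRestriction

/-! ### Real interpolation with the trivial bound from `L^1` to `L^∞`. -/

section Interpolation

variable {V : Type*} [NormedAddCommGroup V] [InnerProductSpace ℝ V] [FiniteDimensional ℝ V]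
  [MeasurableSpace V] [BorelSpace V]

theorem enorm_rpow_eq_ofReal (z : ℂ) {p : ℝ} (hp : 0 ≤ p) : ‖z‖ₑ ^ p = ENNReal.ofReal (‖z‖ ^ p) := by
  rw [← ofReal_norm, ENNReal.ofReal_rpow_of_nonneg (norm_nonneg _) hp]

/-- Cut `φ` at the height `h` with `h^(1-s) = l`. Where `|φ| > h` one has `|φ| ≤ l |φ|^s`, so the
high part has `L^1` norm at most `l` and its transform never exceeds `l`. Hence `|φ̂| > 2l` forces
the transform of the low part to be at least `l`, and Chebyshev with the `L^p → L^q` bound applies.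
-/
theorem meas_lt_norm_fourier_le {ν : Measure V} {s p q : ℝ} (hs : 1 < s) (hsp : s < p) (hpq : p ≤ q)
    {C : ℝ≥0} (hC : ∀ φ : 𝓢(V, ℂ), eLpNorm (𝓕 φ : 𝓢(V, ℂ)) (ENNReal.ofReal q) ν
      ≤ C * eLpNorm φ (ENNReal.ofReal p) volume)
    (φ : 𝓢(V, ℂ)) (hφ : ∫⁻ x, ENNReal.ofReal (‖φ x‖ ^ s) ≤ 1) {l : ℝ} (hl : 0 < l) :
    ν {ξ | l < ‖𝓕 φ ξ‖ / 2} ≤ C ^ q * ENNReal.ofReal (l ^ (-q - (p - s) * (q / p - 1) / (s - 1))) *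
      ∫⁻ x in {x | ‖φ x‖ ≤ l ^ (-1 / (s - 1))}, ENNReal.ofReal (‖φ x‖ ^ p) := by
  have hs0 : 0 < s - 1 := by linarith
  have hp0 : 0 < p := by linarith
  have hq0 : 0 < q := by linarith
  set h := l ^ (-1 / (s - 1)) with hh
  have h0 : 0 < h := Real.rpow_pos_of_pos hl _
  have hhl : h ^ (1 - s) = l := by
    rw [hh, ← Real.rpow_mul hl.le, show -1 / (s - 1) * (1 - s) = 1 by field_simp; ring,
      Real.rpow_one]
  set A := {x | ‖φ x‖ ≤ h} with hA
  have mA : MeasurableSet A := measurableSet_le φ.continuous.norm.measurable measurable_const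
  have hhi : ∀ ξ, ‖𝓕 (Aᶜ.indicator φ) ξ‖ₑ ≤ ENNReal.ofReal l := by
    intro ξ
    refine (enorm_fourier_le _ ξ).trans ?_
    rw [eLpNorm_one_eq_lintegral_enorm]
    calc ∫⁻ x, ‖Aᶜ.indicator φ x‖ₑ ≤ ∫⁻ x, ENNReal.ofReal l * ENNReal.ofReal (‖φ x‖ ^ s) := by
          refine lintegral_mono fun x => ?_
          by_cases hx : x ∈ A
          · rw [Set.indicator_of_notMem (by simpa using hx)]
            simp
          · rw [Set.indicator_of_mem hx, ← ofReal_norm, ← ENNReal.ofReal_mul hl.le]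
            refine ENNReal.ofReal_le_ofReal ?_
            have hx' : h < ‖φ x‖ := not_le.1 hx
            have hx0 : 0 < ‖φ x‖ := h0.trans hx'
            calc ‖φ x‖ = ‖φ x‖ ^ (1 - s) * ‖φ x‖ ^ s := by
                  rw [← Real.rpow_add hx0, sub_add_cancel, Real.rpow_one]
              _ ≤ _ := by
                  rw [← hhl]
                  exact mul_le_mul_of_nonneg_right
                    (Real.rpow_le_rpow_of_nonpos h0 hx'.le (by linarith)) (by positivity)
      _ ≤ ENNReal.ofReal l := by
          rw [lintegral_const_mul' _ _ ENNReal.ofReal_ne_top]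
          exact mul_le_of_le_one_right' hφ
  have hlo_mem : ∀ r : ℝ≥0∞, MemLp (A.indicator φ) r volume := fun r => (φ.memLp r volume).indicator mA
  have hsub : {ξ | l < ‖𝓕 φ ξ‖ / 2} ⊆ {ξ | ENNReal.ofReal l ≤ ‖𝓕 (A.indicator φ) ξ‖ₑ} := by
    intro ξ hξ
    by_contra hcon
    simp only [Set.mem_ofPred_eq, not_le] at hξ hcon
    have e : (φ : V → ℂ) = A.indicator φ + Aᶜ.indicator φ := (Set.indicator_self_add_compl A φ).symm
    have e2 : ‖𝓕 φ ξ‖ₑ ≤ ENNReal.ofReal l + ENNReal.ofReal l := by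
      rw [fourier_coe]
      nth_rewrite 1 [e]
      rw [fourier_add_of_integrable (φ.integrable.indicator mA) (φ.integrable.indicator mA.compl)]
      exact (enorm_add_le _ _).trans (add_le_add hcon.le (hhi ξ))
    rw [← ENNReal.ofReal_add hl.le hl.le, ← ofReal_norm, ENNReal.ofReal_le_ofReal_iff (by linarith)]
      at e2
    linarith
  set J := ∫⁻ x in A, ENNReal.ofReal (‖φ x‖ ^ p) with hJ
  have hJle : J ≤ ENNReal.ofReal (h ^ (p - s)) := by
    calc J ≤ ∫⁻ x in A, ENNReal.ofReal (h ^ (p - s)) * ENNReal.ofReal (‖φ x‖ ^ s) := by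
          refine setLIntegral_mono' mA fun x hx => ?_
          rw [← ENNReal.ofReal_mul (by positivity)]
          refine ENNReal.ofReal_le_ofReal ?_
          calc ‖φ x‖ ^ p = ‖φ x‖ ^ (p - s) * ‖φ x‖ ^ s := by
                rw [← Real.rpow_add_of_nonneg (norm_nonneg _) (by linarith) (by linarith),
                  sub_add_cancel]
            _ ≤ _ := by
                exact mul_le_mul_of_nonneg_right
                  (Real.rpow_le_rpow (norm_nonneg _) hx (by linarith)) (by positivity)
      _ ≤ ENNReal.ofReal (h ^ (p - s)) := by
          rw [lintegral_const_mul' _ _ ENNReal.ofReal_ne_top]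
          exact mul_le_of_le_one_right' ((setLIntegral_le_lintegral _ _).trans hφ)
  have hJnorm : eLpNorm (A.indicator φ) (ENNReal.ofReal p) volume ^ p = J := by
    have := eLpNorm_indicator_rpow (μ := volume) (p := ENNReal.ofReal p) (by simpa) (by simp) φ mA
    rw [ENNReal.toReal_ofReal hp0.le] at this
    rw [this]
    exact lintegral_congr fun x => enorm_rpow_eq_ofReal _ hp0.le
  -- Of the power `J^(q/p)` one factor `J` is kept and the rest is estimated by `J ≤ h^(p-s)`: the
  -- bound must stay linear in `J` for Fubini to apply in the layer-cake integral.
  have hJq : eLpNorm (A.indicator φ) (ENNReal.ofReal p) volume ^ q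
      ≤ ENNReal.ofReal (l ^ (-((p - s) * (q / p - 1) / (s - 1)))) * J := by
    have e1 : q = p * ((q / p - 1) + 1) := by field_simp; ring
    have e2 : 0 ≤ q / p - 1 := by
      rw [sub_nonneg, le_div_iff₀ hp0]; linarith
    conv_lhs => rw [e1, ENNReal.rpow_mul, hJnorm, ENNReal.rpow_add_of_nonneg _ _ e2 zero_le_one,
      ENNReal.rpow_one]
    gcongr
    refine (ENNReal.rpow_le_rpow hJle e2).trans_eq ?_
    rw [ENNReal.ofReal_rpow_of_nonneg (by positivity) e2, hh, ← Real.rpow_mul hl.le,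
      ← Real.rpow_mul hl.le]
    congr 2
    field_simp
  have hF : Continuous (𝓕 (A.indicator φ)) :=
    continuous_fourier_of_integrable (memLp_one_iff_integrable.1 (hlo_mem 1))
  have hcheb := meas_ge_le_mul_pow_eLpNorm_enorm ν (p := ENNReal.ofReal q) (by simpa) (by simp)
    hF.aestronglyMeasurable (ε := ENNReal.ofReal l) (by simpa) (by simp)
  rw [ENNReal.toReal_ofReal hq0.le] at hcheb
  have hbound := eLpNorm_fourier_le_of_memLp (ENNReal.one_le_ofReal.2 (by linarith))
    ENNReal.ofReal_ne_top hC (hlo_mem _) (memLp_one_iff_integrable.1 (hlo_mem 1))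
  calc ν {ξ | l < ‖𝓕 φ ξ‖ / 2}
      ≤ (ENNReal.ofReal l)⁻¹ ^ q * eLpNorm (𝓕 (A.indicator φ)) (ENNReal.ofReal q) ν ^ q :=
        (measure_mono hsub).trans hcheb
    _ ≤ ENNReal.ofReal (l ^ (-q)) *
        (C ^ q * (ENNReal.ofReal (l ^ (-((p - s) * (q / p - 1) / (s - 1)))) * J)) := by
        gcongr
        · rw [ENNReal.inv_rpow, ← ENNReal.rpow_neg, ENNReal.ofReal_rpow_of_pos hl]
        · refine (ENNReal.rpow_le_rpow hbound hq0.le).trans ?_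
          rw [ENNReal.mul_rpow_of_nonneg _ _ hq0.le]
          gcongr
    _ = _ := by
        rw [sub_eq_add_neg (-q), Real.rpow_add hl, ENNReal.ofReal_mul (by positivity)]
        ring

/-- Interpolation of an `L^p → L^q` bound for the Fourier transform with the trivial
`L^1 → L^∞` bound, at functions of norm one. -/
theorem lintegral_fourier_rpow_le {ν : Measure V} {s p q : ℝ} (hs : 1 < s) (hsp : s < p)
    (hpq : p ≤ q) {C : ℝ≥0} (hC : ∀ φ : 𝓢(V, ℂ), eLpNorm (𝓕 φ : 𝓢(V, ℂ)) (ENNReal.ofReal q) ν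
      ≤ C * eLpNorm φ (ENNReal.ofReal p) volume)
    {t : ℝ} (ht : t = q * (s / (s - 1)) / (p / (p - 1)))
    (φ : 𝓢(V, ℂ)) (hφ : ∫⁻ x, ENNReal.ofReal (‖φ x‖ ^ s) ≤ 1) :
    ∫⁻ ξ, ENNReal.ofReal ((‖𝓕 φ ξ‖ / 2) ^ t) ∂ν
      ≤ ENNReal.ofReal t * (C ^ q * ENNReal.ofReal ((s - 1) / (p - s))) := by
  have hs0 : 0 < s - 1 := by linarith
  have hp0 : 0 < p := by linarith
  have hp1 : 0 < p - 1 := by linarith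
  have hq0 : 0 < q := by linarith
  have hps : 0 < p - s := by linarith
  have ht0 : 0 < t := by rw [ht]; positivity
  set a := (p - s) * (q / p - 1) / (s - 1) with ha
  set b := (p - s) / (s - 1) with hb
  have hb0 : 0 < b := by positivity
  -- This identity determines the target exponent `t`: the total power of `l` becomes `b - 1 > -1`,
  -- integrable at `0`.
  have hexp : -q - a + (t - 1) = b - 1 := by
    rw [ht, ha, hb]
    field_simp
    ring
  have hmeas : Measurable fun z : ℝ × V => {z : ℝ × V | ‖φ z.2‖ ≤ z.1 ^ (-1 / (s - 1))}.indicator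
      (fun z => ENNReal.ofReal (z.1 ^ (b - 1)) * ENNReal.ofReal (‖φ z.2‖ ^ p)) z := by
    have hφm : Measurable φ := φ.continuous.measurable
    refine Measurable.indicator (by fun_prop) (measurableSet_le (by fun_prop) (by fun_prop))
  rw [lintegral_rpow_eq_lintegral_meas_lt_mul ν (.of_forall fun ξ => by positivity)
    (Continuous.aemeasurable (by fun_prop)) ht0]
  gcongr
  calc ∫⁻ l in Set.Ioi 0, ν {ξ | l < ‖𝓕 φ ξ‖ / 2} * ENNReal.ofReal (l ^ (t - 1))
      ≤ ∫⁻ l in Set.Ioi 0, C ^ q * ∫⁻ x, {z : ℝ × V | ‖φ z.2‖ ≤ z.1 ^ (-1 / (s - 1))}.indicator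
          (fun z => ENNReal.ofReal (z.1 ^ (b - 1)) * ENNReal.ofReal (‖φ z.2‖ ^ p)) (l, x) := by
        refine setLIntegral_mono' measurableSet_Ioi fun l (hl : 0 < l) => ?_
        refine (mul_le_mul_left (meas_lt_norm_fourier_le hs hsp hpq hC φ hφ hl) _).trans_eq ?_
        rw [← ha, mul_assoc, mul_assoc, mul_comm (∫⁻ x in _, _), ← mul_assoc (ENNReal.ofReal _),
          ← ENNReal.ofReal_mul (by positivity), ← Real.rpow_add hl, hexp,
          ← lintegral_indicator (measurableSet_le φ.continuous.norm.measurable measurable_const),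
          ← lintegral_const_mul' _ _ ENNReal.ofReal_ne_top]
        congr 2
        ext x
        simp only [Set.indicator_apply, Set.mem_ofPred_eq]
        split_ifs <;> simp
    _ = C ^ q * ∫⁻ x, ∫⁻ l in Set.Ioi 0, {z : ℝ × V | ‖φ z.2‖ ≤ z.1 ^ (-1 / (s - 1))}.indicator
          (fun z => ENNReal.ofReal (z.1 ^ (b - 1)) * ENNReal.ofReal (‖φ z.2‖ ^ p)) (l, x) := by
        rw [lintegral_const_mul' _ _ (ENNReal.rpow_ne_top_of_nonneg hq0.le ENNReal.coe_ne_top),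
          lintegral_lintegral_swap hmeas.aemeasurable]
    _ ≤ C ^ q * ∫⁻ x, ENNReal.ofReal ((s - 1) / (p - s)) * ENNReal.ofReal (‖φ x‖ ^ s) := by
        gcongr with x
        by_cases hx : ‖φ x‖ = 0
        · have : ∀ l : ℝ, {z : ℝ × V | ‖φ z.2‖ ≤ z.1 ^ (-1 / (s - 1))}.indicator
            (fun z => ENNReal.ofReal (z.1 ^ (b - 1)) * ENNReal.ofReal (‖φ z.2‖ ^ p)) (l, x) = 0 := by
            intro l
            simp only [Set.indicator_apply, hx, Real.zero_rpow hp0.ne', ENNReal.ofReal_zero,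
              mul_zero, ite_self]
          simp [this]
        · have hx0 : 0 < ‖φ x‖ := lt_of_le_of_ne (norm_nonneg _) (Ne.symm hx)
          -- For fixed `x` the truncation condition says `l ≤ Λ`. Integrating `l^(b-1)` up to `Λ`
          -- gives `|φ x|^(-(p-s)) / b`, which turns `|φ x|^p` into `|φ x|^s`.
          set Λ := ‖φ x‖ ^ (-(s - 1)) with hΛ
          have hΛ0 : 0 < Λ := by positivity
          calc ∫⁻ l in Set.Ioi 0, {z : ℝ × V | ‖φ z.2‖ ≤ z.1 ^ (-1 / (s - 1))}.indicator
                (fun z => ENNReal.ofReal (z.1 ^ (b - 1)) * ENNReal.ofReal (‖φ z.2‖ ^ p)) (l, x)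
              ≤ ∫⁻ l in Set.Ioi 0, (Set.Ioc 0 Λ).indicator
                (fun l => ENNReal.ofReal (l ^ (b - 1)) * ENNReal.ofReal (‖φ x‖ ^ p)) l := by
                refine setLIntegral_mono' measurableSet_Ioi fun l (hl : 0 < l) => ?_
                by_cases h : ‖φ x‖ ≤ l ^ (-1 / (s - 1))
                · rw [Set.indicator_of_mem (by exact h), Set.indicator_of_mem]
                  refine ⟨hl, ?_⟩
                  calc l = (l ^ (-1 / (s - 1))) ^ (-(s - 1)) := by
                        rw [← Real.rpow_mul hl.le, show -1 / (s - 1) * -(s - 1) = 1 by field_simp,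
                          Real.rpow_one]
                    _ ≤ Λ := Real.rpow_le_rpow_of_nonpos hx0 h (by linarith)
                · rw [Set.indicator_of_notMem (by exact h)]
                  exact zero_le
            _ ≤ ∫⁻ l in Set.Ioc 0 Λ, ENNReal.ofReal (l ^ (b - 1)) * ENNReal.ofReal (‖φ x‖ ^ p) := by
                rw [← lintegral_indicator measurableSet_Ioc]
                exact setLIntegral_le_lintegral _ _
            _ = ENNReal.ofReal (Λ ^ b / b) * ENNReal.ofReal (‖φ x‖ ^ p) := by
                rw [lintegral_mul_const' _ _ ENNReal.ofReal_ne_top,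
                  ← ofReal_integral_eq_lintegral_ofReal,
                  ← intervalIntegral.integral_of_le hΛ0.le, integral_rpow (Or.inl (by linarith)),
                  sub_add_cancel, Real.zero_rpow hb0.ne', sub_zero]
                · exact (intervalIntegral.intervalIntegrable_rpow' (by linarith)).1
                · filter_upwards [ae_restrict_mem measurableSet_Ioc] with l hl
                  exact Real.rpow_nonneg hl.1.le _
            _ = _ := by
                rw [← ENNReal.ofReal_mul (by positivity), ← ENNReal.ofReal_mul (by positivity), hΛ,
                  ← Real.rpow_mul hx0.le, show -(s - 1) * b = -(p - s) by rw [hb]; field_simp]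
                congr 1
                rw [div_mul_eq_mul_div, ← Real.rpow_add hx0, hb,
                  show -(p - s) + p = s by ring]
                field_simp
    _ ≤ C ^ q * ENNReal.ofReal ((s - 1) / (p - s)) := by
        rw [lintegral_const_mul' _ _ ENNReal.ofReal_ne_top]
        gcongr
        exact mul_le_of_le_one_right' hφ

/-- Both sides are homogeneous, so the case of norm one suffices. The factor `2` in `K` undoes the
halving of `|φ̂|` caused by the splitting. -/
theorem exists_eLpNorm_fourier_le_of_lt {ν : Measure V} {s p q : ℝ} (hs : 1 < s) (hsp : s < p)
    (hpq : p ≤ q) {C : ℝ≥0} (hC : ∀ φ : 𝓢(V, ℂ), eLpNorm (𝓕 φ : 𝓢(V, ℂ)) (ENNReal.ofReal q) ν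
      ≤ C * eLpNorm φ (ENNReal.ofReal p) volume)
    {t : ℝ} (ht : t = q * (s / (s - 1)) / (p / (p - 1))) :
    ∃ K : ℝ≥0, ∀ φ : 𝓢(V, ℂ), eLpNorm (𝓕 φ : 𝓢(V, ℂ)) (ENNReal.ofReal t) ν
      ≤ K * eLpNorm φ (ENNReal.ofReal s) volume := by
  have hs0 : 0 < s := by linarith
  have hs1 : 0 < s - 1 := by linarith
  have hp0 : 0 < p := by linarith
  have hp1 : 0 < p - 1 := by linarith
  have hq0 : 0 < q := by linarith
  have ht0 : 0 < t := by rw [ht]; positivity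
  have hsE : ENNReal.ofReal s ≠ 0 := by simpa
  have htE : ENNReal.ofReal t ≠ 0 := by simpa
  set M : ℝ≥0∞ := ENNReal.ofReal t * (C ^ q * ENNReal.ofReal ((s - 1) / (p - s))) with hM
  have hMtop : M ≠ ∞ := ENNReal.mul_ne_top ENNReal.ofReal_ne_top
    (ENNReal.mul_ne_top (ENNReal.rpow_ne_top_of_nonneg hq0.le ENNReal.coe_ne_top)
      ENNReal.ofReal_ne_top)
  set K : ℝ≥0∞ := 2 * M ^ (1 / t) with hK
  have hKtop : K ≠ ∞ :=
    ENNReal.mul_ne_top (by simp) (ENNReal.rpow_ne_top_of_nonneg (by positivity) hMtop)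
  have unit : ∀ φ : 𝓢(V, ℂ), eLpNorm φ (ENNReal.ofReal s) volume = 1 →
      eLpNorm (𝓕 φ : 𝓢(V, ℂ)) (ENNReal.ofReal t) ν ≤ K := by
    intro φ hφ
    have h1 : ∫⁻ x, ENNReal.ofReal (‖φ x‖ ^ s) ≤ 1 := by
      have := eLpNorm_rpow_eq_lintegral (μ := volume) hsE ENNReal.ofReal_ne_top φ
      rw [hφ, ENNReal.one_rpow, ENNReal.toReal_ofReal hs0.le] at this
      rw [this]
      exact (lintegral_congr fun x => (enorm_rpow_eq_ofReal _ hs0.le).symm).le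
    have h2 := lintegral_fourier_rpow_le hs hsp hpq hC ht φ h1
    rw [← ENNReal.rpow_le_rpow_iff ht0]
    have h3 := eLpNorm_rpow_eq_lintegral (μ := ν) htE ENNReal.ofReal_ne_top (𝓕 φ : 𝓢(V, ℂ))
    rw [ENNReal.toReal_ofReal ht0.le] at h3
    rw [h3, hK, ENNReal.mul_rpow_of_nonneg _ _ ht0.le, ← ENNReal.rpow_mul, one_div,
      inv_mul_cancel₀ ht0.ne', ENNReal.rpow_one]
    calc ∫⁻ ξ, ‖𝓕 φ ξ‖ₑ ^ t ∂ν = ∫⁻ ξ, 2 ^ t * ENNReal.ofReal ((‖𝓕 φ ξ‖ / 2) ^ t) ∂ν := by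
          refine lintegral_congr fun ξ => ?_
          rw [enorm_rpow_eq_ofReal _ ht0.le, show (2 : ℝ≥0∞) = ENNReal.ofReal 2 by simp,
            ENNReal.ofReal_rpow_of_pos two_pos, ← ENNReal.ofReal_mul (by positivity),
            ← Real.mul_rpow (by norm_num) (by positivity), mul_div_cancel₀ _ (by norm_num)]
      _ ≤ 2 ^ t * M := by
          rw [lintegral_const_mul' _ _ (ENNReal.rpow_ne_top_of_nonneg ht0.le (by simp))]
          gcongr
  refine ⟨K.toNNReal, fun φ => ?_⟩
  rw [ENNReal.coe_toNNReal hKtop]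
  have htop := (φ.memLp (ENNReal.ofReal s) volume).eLpNorm_ne_top
  by_cases h0 : eLpNorm φ (ENNReal.ofReal s) volume = 0
  · have h1 : (φ : V → ℂ) =ᵐ[volume] 0 := (eLpNorm_eq_zero_iff φ.continuous.aestronglyMeasurable hsE).1 h0
    have h2 : ∀ ξ, 𝓕 φ ξ = 0 := fun ξ => by
      have := enorm_fourier_le φ ξ
      rw [(eLpNorm_eq_zero_iff φ.continuous.aestronglyMeasurable one_ne_zero).2 h1] at this
      rw [fourier_coe]
      simpa using this
    have h3 : ⇑(𝓕 φ : 𝓢(V, ℂ)) = 0 := funext h2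
    rw [h3]
    simp
  · set c : ℝ := (eLpNorm φ (ENNReal.ofReal s) volume).toReal with hc
    have hc0 : 0 < c := ENNReal.toReal_pos h0 htop
    have hce : ENNReal.ofReal c = eLpNorm φ (ENNReal.ofReal s) volume := ENNReal.ofReal_toReal htop
    have hsm : ∀ ψ : 𝓢(V, ℂ), ⇑((c⁻¹ : ℂ) • ψ) = (c⁻¹ : ℂ) • ⇑ψ := fun _ => rfl
    have h1 := unit ((c⁻¹ : ℂ) • φ) (by
      rw [hsm, eLpNorm_const_smul, enorm_inv (by exact_mod_cast hc0.ne'), ← hce,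
        ← ofReal_norm, Complex.norm_real, Real.norm_of_nonneg hc0.le]
      exact ENNReal.inv_mul_cancel (by simpa) (by simp))
    rw [FourierTransform.fourier_smul, hsm, eLpNorm_const_smul,
      enorm_inv (by exact_mod_cast hc0.ne'), ← ofReal_norm, Complex.norm_real,
      Real.norm_of_nonneg hc0.le, mul_comm, ← div_eq_mul_inv, ENNReal.div_le_iff (by simpa) (by simp),
      hce] at h1
    exact h1

end Interpolation

end FourierRestriction

namespace FourierRestriction

/-! ### The restriction operator and convergence of smooth averages. -/

section Convergence

variable {d : ℕ} {ν : Measure (EuclideanSpace ℝ (Fin d))} {s t : ℝ≥0∞}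

theorem IsRestrictionOperator.exists_eLpNorm_le
    {R : Lp ℂ s (volume : Measure (EuclideanSpace ℝ (Fin d))) →ₗ[ℂ] Lp ℂ t ν}
    (hR : IsRestrictionOperator ν s t R) :
    ∃ C : ℝ≥0, ∀ f, eLpNorm (R f) t ν ≤ C * eLpNorm f s volume := by
  obtain ⟨C, hC⟩ := hR.bounded
  refine ⟨C.toNNReal, fun f => ?_⟩
  have h := hC f
  rw [Lp.norm_def, Lp.norm_def] at h
  rw [← ENNReal.ofReal_toReal (Lp.eLpNorm_ne_top (R f)),
    ← ENNReal.ofReal_toReal (Lp.eLpNorm_ne_top f), ← ENNReal.ofReal_coe_nnreal,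
    ← ENNReal.ofReal_mul (by positivity)]
  refine ENNReal.ofReal_le_ofReal (h.trans ?_)
  gcongr
  exact Real.le_coe_toNNReal C

theorem existsUnique_isRestrictionOperator [Fact (1 ≤ s)] (hs : s ≠ ∞) (ht : 1 ≤ t)
    (hest : APrioriEstimate ν s t) :
    ∃! R : Lp ℂ s (volume : Measure (EuclideanSpace ℝ (Fin d))) →ₗ[ℂ] Lp ℂ t ν,
      IsRestrictionOperator ν s t R := by
  have : Fact (1 ≤ t) := ⟨ht⟩
  obtain ⟨C, hC⟩ := hest
  have hmem : ∀ φ : 𝓢(EuclideanSpace ℝ (Fin d), ℂ),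
      MemLp (𝓕 φ : 𝓢(EuclideanSpace ℝ (Fin d), ℂ)) t ν := fun φ =>
    ⟨(𝓕 φ).continuous.aestronglyMeasurable, (hC φ).trans_lt
      (ENNReal.mul_lt_top ENNReal.coe_lt_top (φ.memLp s volume).eLpNorm_lt_top)⟩
  let T : 𝓢(EuclideanSpace ℝ (Fin d), ℂ) →ₗ[ℂ] Lp ℂ t ν :=
    { toFun := fun φ => (hmem φ).toLp _
      map_add' := fun φ ψ => by
        rw [← MemLp.toLp_add]
        congr 1
        rw [FourierTransform.fourier_add]
        rfl
      map_smul' := fun c φ => by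
        rw [RingHom.id_apply, ← MemLp.toLp_const_smul]
        congr 1
        rw [FourierTransform.fourier_smul]
        rfl }
  let e : 𝓢(EuclideanSpace ℝ (Fin d), ℂ) →ₗ[ℂ] Lp ℂ s (volume : Measure (EuclideanSpace ℝ (Fin d))) :=
    (toLpCLM ℂ ℂ s volume).toLinearMap
  have hdense : DenseRange e :=
    denseRange_toLpCLM (E := EuclideanSpace ℝ (Fin d)) (F := ℂ) (μ := volume) hs
  have hbound : ∀ φ, ‖T φ‖ ≤ C * ‖e φ‖ := by
    intro φ
    have h1 : ‖T φ‖ₑ ≤ C * ‖e φ‖ₑ := by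
      have h2 : ‖e φ‖ₑ = eLpNorm φ s volume := by
        rw [Lp.enorm_def]
        exact eLpNorm_congr_ae (φ.coeFn_toLp s volume)
      rw [h2, Lp.enorm_def]
      exact (eLpNorm_congr_ae (hmem φ).coeFn_toLp).trans_le (hC φ)
    rw [← ofReal_norm, ← ofReal_norm, ← ENNReal.ofReal_coe_nnreal,
      ← ENNReal.ofReal_mul (by positivity), ENNReal.ofReal_le_ofReal_iff (by positivity)] at h1
    exact h1
  refine ⟨(T.extendOfNorm e).toLinearMap, ⟨⟨C, fun f => ?_⟩, fun φ => ?_⟩, fun R hR => ?_⟩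
  · exact LinearMap.norm_extendOfNorm_apply_le hdense C hbound f
  · have := LinearMap.extendOfNorm_eq (f := T) (e := e) hdense ⟨C, hbound⟩ φ
    change (T.extendOfNorm e (e φ) : EuclideanSpace ℝ (Fin d) → ℂ) =ᵐ[ν] _
    rw [this]
    exact (hmem φ).coeFn_toLp
  · obtain ⟨D, hD⟩ := hR.bounded
    let R' := R.mkContinuous D hD
    have : T.extendOfNorm e = R' := by
      refine LinearMap.extendOfNorm_unique hdense C hbound R' (LinearMap.ext fun φ => ?_)
      refine Lp.ext ?_
      exact (hR.eq_fourier φ).trans (hmem φ).coeFn_toLp.symm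
    rw [this]
    rfl

theorem fourierLp_sub [Fact (1 ≤ s)] (f g : Lp ℂ s (volume : Measure (EuclideanSpace ℝ (Fin d)))) :
    fourierLp (f - g) = fourierLp f - fourierLp g := by
  simp only [fourierLp, ← Lp.toTemperedDistributionCLM_apply, map_sub]
  rfl

theorem conv_sub (u v : 𝓢'(EuclideanSpace ℝ (Fin d), ℂ)) (φ : 𝓢(EuclideanSpace ℝ (Fin d), ℂ))
    (ξ : EuclideanSpace ℝ (Fin d)) : conv (u - v) φ ξ = conv u φ ξ - conv v φ ξ := rfl

theorem enorm_conv_le_maximalFunction (u : 𝓢'(EuclideanSpace ℝ (Fin d), ℂ))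
    (χ : 𝓢(EuclideanSpace ℝ (Fin d), ℂ)) (r : PosParam d) (ξ : EuclideanSpace ℝ (Fin d)) :
    ‖conv u (dilate χ r) ξ‖ₑ ≤ maximalFunction u χ ξ :=
  le_iSup (fun r => ‖conv u (dilate χ r) ξ‖ₑ) r

instance : (toZero d).IsCountablyGenerated := by unfold toZero; infer_instance

/-- For an integrable function the convolutions converge at every point. -/
theorem tendsto_conv_of_integrable [Fact (1 ≤ s)]
    (f : Lp ℂ s (volume : Measure (EuclideanSpace ℝ (Fin d)))) (hf : Integrable f)
    {χ : 𝓢(EuclideanSpace ℝ (Fin d), ℂ)} (hχ : ∫ x, χ x = 1) (ξ : EuclideanSpace ℝ (Fin d)) :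
    Tendsto (fun r => conv (fourierLp f) (dilate χ r) ξ) (toZero d) (𝓝 (𝓕 (f : _ → ℂ) ξ)) := by
  simp only [conv_fourierLp]
  obtain ⟨M, hM⟩ : ∃ M : ℝ, ∀ x, ‖𝓕⁻ χ x‖ ≤ M :=
    ⟨_, fun x => norm_le_seminorm ℝ (𝓕⁻ χ) x⟩
  refine tendsto_fourier_of_dominated (G := fun x => ‖f x‖ * M)
    (fun r => (integrable_mul_schwartz Fact.out (Lp.memLp f) _).1) (hf.norm.mul_const M)
    (fun r => .of_forall fun x => ?_) (.of_forall fun x => ?_) ξ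
  · rw [Pi.mul_apply, norm_mul, fourierInv_dilate]
    gcongr
    exact hM _
  · have h0 : 𝓕⁻ χ 0 = 1 := by
      rw [fourierInv_coe, Real.fourierInv_eq, ← hχ]
      simp
    have h1 : Continuous fun r : Fin d → ℝ => 𝓕⁻ χ (WithLp.toLp 2 fun j => r j * x j) := by
      have := (𝓕⁻ χ).continuous
      fun_prop
    have h2 := (h1.tendsto 0).comp (tendsto_comap : Tendsto
      (fun r : PosParam d => (r : Fin d → ℝ)) (toZero d) (𝓝 0))
    have h3 : (WithLp.toLp 2 fun j => (0 : Fin d → ℝ) j * x j : EuclideanSpace ℝ (Fin d)) = 0 := by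
      ext j; simp
    rw [h3, h0] at h2
    have h4 := h2.const_mul (f x)
    rw [mul_one] at h4
    exact h4.congr fun r => by simp [fourierInv_dilate]

/-- A weak substitute for almost everywhere convergence that needs no subsequence: at almost every
point some `h n y` is arbitrarily small, which is all the density arguments use. -/
theorem ae_liminf_eq_zero {Y : Type*} [MeasurableSpace Y] {ν : Measure Y} {q : ℝ≥0∞}
    (hq0 : q ≠ 0) (hq : q ≠ ∞) {h : ℕ → Y → ℝ≥0∞} (hm : ∀ n, Measurable (h n))
    (hlim : Tendsto (fun n => eLpNorm (h n) q ν) atTop (𝓝 0)) :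
    ∀ᵐ y ∂ν, liminf (fun n => h n y) atTop = 0 := by
  have h1 : eLpNorm (fun y => liminf (fun n => h n y) atTop) q ν = 0 := by
    refine le_antisymm (le_of_forall_gt fun ε hε => ?_) zero_le
    obtain ⟨δ, hδ, hδε⟩ := exists_between hε
    obtain ⟨N, hN⟩ := eventually_atTop.1 (hlim.eventually (gt_mem_nhds hδ))
    refine lt_of_le_of_lt ?_ hδε
    refine eLpNorm_le_of_le_liminf hq0 hq (h := fun n => h (n + N)) (fun n => hm _)
      (.of_forall fun y => ?_) fun n => (hN (n + N) (by omega)).le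
    exact (liminf_nat_add (fun n => h n y) N).ge
  rw [eLpNorm_eq_zero_iff (Measurable.liminf hm).aestronglyMeasurable hq0] at h1
  exact h1

theorem IsRestrictionOperator.ae_eq_fourier_sub
    {R : Lp ℂ s (volume : Measure (EuclideanSpace ℝ (Fin d))) →ₗ[ℂ] Lp ℂ t ν}
    (hR : IsRestrictionOperator ν s t R)
    (f : Lp ℂ s (volume : Measure (EuclideanSpace ℝ (Fin d))))
    (φ : 𝓢(EuclideanSpace ℝ (Fin d), ℂ)) :
    R (f - φ.toLp s volume) =ᵐ[ν] fun ξ => R f ξ - 𝓕 φ ξ := by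
  rw [map_sub]
  filter_upwards [Lp.coeFn_sub (R f) (R (φ.toLp s volume)), hR.eq_fourier φ] with ξ h1 h2
  rw [h1, Pi.sub_apply, h2]

theorem measurable_enorm_Lp {E' : Type*} [NormedAddCommGroup E'] {Y : Type*} [MeasurableSpace Y]
    {ν : Measure Y} (f : Lp E' t ν) : Measurable fun y => ‖f y‖ₑ :=
  (Lp.stronglyMeasurable f).enorm

theorem tendsto_enorm_sub_schwartz [Fact (1 ≤ s)]
    {f : Lp ℂ s (volume : Measure (EuclideanSpace ℝ (Fin d)))}
    {φ : ℕ → 𝓢(EuclideanSpace ℝ (Fin d), ℂ)}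
    (hφ : Tendsto (fun n => (φ n).toLp s volume) atTop (𝓝 f)) (C : ℝ≥0) :
    Tendsto (fun n => C * eLpNorm (f - (φ n).toLp s volume :
      Lp ℂ s (volume : Measure (EuclideanSpace ℝ (Fin d)))) s volume) atTop (𝓝 0) := by
  have h1 : Tendsto (fun n => ‖f - (φ n).toLp s volume‖ₑ) atTop (𝓝 ‖f - f‖ₑ) :=
    (hφ.const_sub f).enorm
  rw [sub_self, enorm_zero] at h1
  simpa [Lp.enorm_def] using ENNReal.Tendsto.const_mul (a := (C : ℝ≥0∞)) h1 (Or.inr ENNReal.coe_ne_top)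

/-- For Schwartz functions convergence holds everywhere. The error of approximating `f` is
controlled, for all `r` at once, by the maximal function of the error plus its restriction. Their
sum `u n` tends to `0` in norm, and `n` may be chosen depending on `ξ`. -/
theorem IsRestrictionOperator.ae_tendsto_conv [Fact (1 ≤ s)] (hs : s ≠ ∞) (ht : 1 ≤ t) (ht' : t ≠ ∞)
    {R : Lp ℂ s (volume : Measure (EuclideanSpace ℝ (Fin d))) →ₗ[ℂ] Lp ℂ t ν}
    (hR : IsRestrictionOperator ν s t R) {χ : 𝓢(EuclideanSpace ℝ (Fin d), ℂ)}
    (hχ : ∫ x, χ x = 1)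
    (hmax : ∃ C : ℝ≥0, ∀ f : Lp ℂ s (volume : Measure (EuclideanSpace ℝ (Fin d))),
      eLpNorm (maximalFunction (fourierLp f) χ) t ν ≤ C * eLpNorm f s volume)
    (f : Lp ℂ s (volume : Measure (EuclideanSpace ℝ (Fin d)))) :
    ∀ᵐ ξ ∂ν, Tendsto (fun r => conv (fourierLp f) (dilate χ r) ξ) (toZero d) (𝓝 (R f ξ)) := by
  obtain ⟨C₁, hC₁⟩ := hmax
  obtain ⟨C₂, hC₂⟩ := hR.exists_eLpNorm_le
  obtain ⟨φ, hφ⟩ := exists_schwartz_tendsto_Lp hs f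
  set g : ℕ → Lp ℂ s (volume : Measure (EuclideanSpace ℝ (Fin d))) :=
    fun n => f - (φ n).toLp s volume with hg
  set u : ℕ → EuclideanSpace ℝ (Fin d) → ℝ≥0∞ :=
    fun n => maximalFunction (fourierLp (g n)) χ + fun ξ => ‖R (g n) ξ‖ₑ with hu
  have hum : ∀ n, Measurable (u n) := fun n =>
    (measurable_maximalFunction _ _).add (measurable_enorm_Lp _)
  have hulim : Tendsto (fun n => eLpNorm (u n) t ν) atTop (𝓝 0) := by
    refine tendsto_of_tendsto_of_tendsto_of_le_of_le tendsto_const_nhds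
      (tendsto_enorm_sub_schwartz hφ (C₁ + C₂)) (fun _ => zero_le) fun n => ?_
    dsimp only
    refine (eLpNorm_add_le (measurable_maximalFunction _ _).aestronglyMeasurable
      (measurable_enorm_Lp _).aestronglyMeasurable ht).trans ?_
    rw [eLpNorm_enorm, ENNReal.coe_add, add_mul]
    exact add_le_add (hC₁ _) (hC₂ _)
  filter_upwards [ae_liminf_eq_zero (zero_lt_one.trans_le ht).ne' ht' hum hulim,
    ae_all_iff.2 fun n => hR.ae_eq_fourier_sub f (φ n)] with ξ h1 h2
  rw [EMetric.tendsto_nhds]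
  intro ε hε
  have hε2 : 0 < ε / 2 := ENNReal.half_pos hε.ne'
  obtain ⟨n, hn⟩ : ∃ n, u n ξ < ε / 2 := by
    by_contra! hcon
    have : ε / 2 ≤ liminf (fun n => u n ξ) atTop :=
      le_liminf_of_le (by isBoundedDefault) (.of_forall hcon)
    rw [h1] at this
    exact this.not_gt hε2
  have hint : Integrable ((φ n).toLp s volume) :=
    (φ n).integrable.congr ((φ n).coeFn_toLp s volume).symm
  have h3 := tendsto_conv_of_integrable ((φ n).toLp s volume) hint hχ ξ
  have h4 : 𝓕 ((φ n).toLp s volume : _ → ℂ) ξ = 𝓕 (φ n) ξ := by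
    rw [fourier_coe, Real.fourier_eq, Real.fourier_eq]
    refine integral_congr_ae ?_
    filter_upwards [(φ n).coeFn_toLp s volume] with x hx
    rw [hx]
  rw [h4] at h3
  filter_upwards [EMetric.tendsto_nhds.1 h3 (ε / 2) hε2] with r hr
  rw [edist_eq_enorm_sub] at hr ⊢
  have e1 : conv (fourierLp f) (dilate χ r) ξ - R f ξ
      = conv (fourierLp (g n)) (dilate χ r) ξ - R (g n) ξ
        + (conv (fourierLp ((φ n).toLp s volume)) (dilate χ r) ξ - 𝓕 (φ n) ξ) := by
    rw [hg, fourierLp_sub, conv_sub, h2 n]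
    ring
  rw [e1]
  calc _ ≤ ‖conv (fourierLp (g n)) (dilate χ r) ξ - R (g n) ξ‖ₑ + _ := enorm_add_le _ _
    _ ≤ u n ξ + _ := by
        gcongr
        refine enorm_sub_le.trans ?_
        exact add_le_add (enorm_conv_le_maximalFunction _ _ _ _) le_rfl
    _ < ε / 2 + ε / 2 := ENNReal.add_lt_add hn hr
    _ = ε := ENNReal.add_halves ε

theorem eLpNorm_top_fourier_le (ν : Measure (EuclideanSpace ℝ (Fin d)))
    (g : EuclideanSpace ℝ (Fin d) → ℂ) : eLpNorm (𝓕 g) ∞ ν ≤ eLpNorm g 1 volume := by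
  rw [eLpNorm_exponent_top]
  exact eLpNormEssSup_le_of_ae_enorm_bound (.of_forall fun ξ => enorm_fourier_le g ξ)

/-- Both sides are bounded from `L^1` to `L^∞` and agree on Schwartz functions. Being continuous,
the right side settles the endpoint `s = 1`, where the target exponent is infinite and the maximal
argument unavailable. -/
theorem IsRestrictionOperator.ae_eq_fourier_of_one
    {R : Lp ℂ 1 (volume : Measure (EuclideanSpace ℝ (Fin d))) →ₗ[ℂ] Lp ℂ ∞ ν}
    (hR : IsRestrictionOperator ν 1 ∞ R)
    (f : Lp ℂ 1 (volume : Measure (EuclideanSpace ℝ (Fin d)))) :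
    R f =ᵐ[ν] 𝓕 (f : EuclideanSpace ℝ (Fin d) → ℂ) := by
  obtain ⟨C, hC⟩ := hR.exists_eLpNorm_le
  obtain ⟨φ, hφ⟩ := exists_schwartz_tendsto_Lp ENNReal.one_ne_top f
  have hf : Integrable f := L1.integrable_coeFn f
  have hcont := continuous_fourier_of_integrable hf
  have h0 : eLpNorm (⇑(R f) - 𝓕 (f : EuclideanSpace ℝ (Fin d) → ℂ)) ∞ ν = 0 := by
    refine le_antisymm (ge_of_tendsto' (tendsto_enorm_sub_schwartz hφ (C + 1)) fun n => ?_) zero_le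
    set g := f - (φ n).toLp 1 volume with hg
    have hgint : Integrable g := L1.integrable_coeFn g
    have e1 : ⇑(R f) - 𝓕 (f : EuclideanSpace ℝ (Fin d) → ℂ)
        =ᵐ[ν] ⇑(R g) - 𝓕 (g : EuclideanSpace ℝ (Fin d) → ℂ) := by
      filter_upwards [hR.ae_eq_fourier_sub f (φ n)] with ξ hξ
      have e2 : 𝓕 (g : EuclideanSpace ℝ (Fin d) → ℂ) ξ
          = 𝓕 (f : EuclideanSpace ℝ (Fin d) → ℂ) ξ - 𝓕 (φ n) ξ := by
        rw [fourier_coe, ← fourier_sub_of_integrable hf (φ n).integrable, Real.fourier_eq,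
          Real.fourier_eq]
        refine integral_congr_ae ?_
        filter_upwards [Lp.coeFn_sub f ((φ n).toLp 1 volume), (φ n).coeFn_toLp 1 volume] with x h1 h2
        rw [hg, h1, Pi.sub_apply, h2, Pi.sub_apply]
      rw [Pi.sub_apply, Pi.sub_apply, hξ, e2]
      ring
    rw [eLpNorm_congr_ae e1, ENNReal.coe_add, ENNReal.coe_one, add_mul, one_mul]
    refine (eLpNorm_sub_le (Lp.aestronglyMeasurable _)
      (continuous_fourier_of_integrable hgint).aestronglyMeasurable le_top).trans ?_
    exact add_le_add (hC g) (eLpNorm_top_fourier_le ν _)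
  rw [eLpNorm_eq_zero_iff ((Lp.aestronglyMeasurable _).sub hcont.aestronglyMeasurable)
    ENNReal.top_ne_zero] at h0
  filter_upwards [h0] with ξ hξ
  exact sub_eq_zero.1 hξ

theorem aPrioriEstimate_one_top (ν : Measure (EuclideanSpace ℝ (Fin d))) : APrioriEstimate ν 1 ∞ :=
  ⟨1, fun φ => by
    rw [fourier_coe, ENNReal.coe_one, one_mul]
    exact eLpNorm_top_fourier_le ν φ⟩

end Convergence

end FourierRestriction

namespace FourierRestriction

/-! ### Young's inequality and the autocorrelation of a Schwartz function. -/

section Young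

variable {V : Type*} [NormedAddCommGroup V] [InnerProductSpace ℝ V] [FiniteDimensional ℝ V]
  [MeasurableSpace V] [BorelSpace V]

/-- Young's convolution inequality for two factors with the same exponent. -/
theorem lintegral_convolution_rpow_le {u v : V → ℝ≥0∞} (hu : Measurable u) (hv : Measurable v)
    {s p : ℝ} (hs : 1 ≤ s) (hsp : s ≤ p) (h : 2 / s = 1 + 1 / p) :
    ∫⁻ x, (∫⁻ y, u y * v (x - y)) ^ p
      ≤ ((∫⁻ x, u x ^ s) * ∫⁻ x, v x ^ s) ^ (p / s) := by
  have hs0 : 0 < s := by linarith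
  have hp0 : 0 < p := by linarith
  -- Hölder with weights `1/p, α, α`, which sum to `1` by `h`, is applied to `u v = (u^s v^s)^(1/p)
  -- (u^s)^α (v^s)^α`.
  set α := 1 / s - 1 / p with hα
  have hα0 : 0 ≤ α := sub_nonneg.2 (one_div_le_one_div_of_le hs0 hsp)
  have hsum : 1 / p + α + α = 1 := by
    rw [hα]; linear_combination h
  set U := ∫⁻ x, u x ^ s with hU
  set W := ∫⁻ x, v x ^ s with hW
  have hpt : ∀ x, ∫⁻ y, u y * v (x - y)
      ≤ (∫⁻ y, u y ^ s * v (x - y) ^ s) ^ (1 / p) * (U ^ α * W ^ α) := by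
    intro x
    have hvx : Measurable fun y => v (x - y) := hv.comp (measurable_const.sub measurable_id)
    have := ENNReal.lintegral_prod_norm_pow_le (μ := (volume : Measure V)) (Finset.univ : Finset (Fin 3))
      (f := ![fun y => u y ^ s * v (x - y) ^ s, fun y => u y ^ s, fun y => v (x - y) ^ s])
      (fun i _ => by
        fin_cases i
        · exact ((hu.pow_const s).mul (hvx.pow_const s)).aemeasurable
        · exact (hu.pow_const s).aemeasurable
        · exact (hvx.pow_const s).aemeasurable)
      (p := ![1 / p, α, α]) (by simpa [Fin.sum_univ_three] using hsum)
      (fun i _ => by fin_cases i <;> simp [hα0, hp0.le])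
    simp only [Fin.prod_univ_three, Matrix.cons_val_zero, Matrix.cons_val_one, Matrix.cons_val] at this
    rw [lintegral_sub_left_eq_self (fun y => v y ^ s) x, ← hU, ← hW, mul_assoc] at this
    refine le_trans (le_of_eq (lintegral_congr fun y => ?_)) this
    have e : s * (1 / p) + s * α = 1 := by rw [hα]; field_simp; ring
    have key : ∀ z : ℝ≥0∞, z = z ^ (s * (1 / p)) * z ^ (s * α) := fun z => by
      rw [← ENNReal.rpow_add_of_nonneg _ _ (by positivity) (by positivity), e, ENNReal.rpow_one]
    rw [ENNReal.mul_rpow_of_nonneg _ _ (by positivity)]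
    simp only [← ENNReal.rpow_mul]
    conv_lhs => rw [key (u y), key (v (x - y))]
    ring
  have hjoint : Measurable (Function.uncurry fun x y => u y ^ s * v (x - y) ^ s) :=
    ((hu.comp measurable_snd).pow_const s).mul
      ((hv.comp (measurable_fst.sub measurable_snd)).pow_const s)
  calc ∫⁻ x, (∫⁻ y, u y * v (x - y)) ^ p
      ≤ ∫⁻ x, (∫⁻ y, u y ^ s * v (x - y) ^ s) * (U ^ α * W ^ α) ^ p := by
        refine lintegral_mono fun x => ?_
        refine (ENNReal.rpow_le_rpow (hpt x) hp0.le).trans_eq ?_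
        rw [ENNReal.mul_rpow_of_nonneg _ _ hp0.le, ← ENNReal.rpow_mul, one_div,
          inv_mul_cancel₀ hp0.ne', ENNReal.rpow_one]
    _ = (∫⁻ x, ∫⁻ y, u y ^ s * v (x - y) ^ s) * (U ^ α * W ^ α) ^ p :=
        lintegral_mul_const _ hjoint.lintegral_prod_right
    _ = (U * W) * (U ^ α * W ^ α) ^ p := by
        rw [lintegral_lintegral_swap hjoint.aemeasurable]
        congr 1
        calc ∫⁻ y, ∫⁻ x, u y ^ s * v (x - y) ^ s = ∫⁻ y, u y ^ s * W := by
              refine lintegral_congr fun y => ?_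
              have hm : Measurable fun x => v (x - y) := hv.comp (measurable_id.sub_const y)
              rw [lintegral_const_mul _ (hm.pow_const s),
                lintegral_sub_right_eq_self (fun x => v x ^ s) y]
          _ = U * W := lintegral_mul_const _ (hu.pow_const s)
    _ = (U * W) ^ (p / s) := by
        rw [← ENNReal.mul_rpow_of_nonneg _ _ hα0, ← ENNReal.rpow_mul]
        nth_rewrite 1 [← ENNReal.rpow_one (U * W)]
        rw [← ENNReal.rpow_add_of_nonneg _ _ zero_le_one (by positivity)]
        congr 1
        rw [hα]
        field_simp
        ring

/-- The squared modulus of the Fourier transform of a Schwartz function `φ` is the Fourier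
transform of the autocorrelation of `φ`. -/
theorem exists_fourier_eq_norm_sq (φ : 𝓢(V, ℂ)) {s p : ℝ} (hs : 1 ≤ s) (hsp : s ≤ p)
    (h : 2 / s = 1 + 1 / p) :
    ∃ η : 𝓢(V, ℂ), (∀ ξ, 𝓕 η ξ = ((‖𝓕 φ ξ‖ ^ 2 : ℝ) : ℂ)) ∧
      eLpNorm η (ENNReal.ofReal p) volume ≤ eLpNorm φ (ENNReal.ofReal s) volume ^ 2 := by
  have hs0 : 0 < s := by linarith
  have hp0 : 0 < p := by linarith
  -- `φ'(x)` is the conjugate of `φ(-x)`, so its transform is the conjugate of `φ̂`, and `η = φ *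
  -- φ'` has transform `|φ̂|²`.
  let φ' : 𝓢(V, ℂ) := postcompCLM (𝕜 := ℝ) (Complex.conjCLE : ℂ →L[ℝ] ℂ)
    (compCLMOfContinuousLinearEquiv ℝ (ContinuousLinearEquiv.neg ℝ) φ)
  have hφ' : ∀ x, φ' x = starRingEnd ℂ (φ (-x)) := fun x => rfl
  have hF : ∀ ξ, 𝓕 φ' ξ = starRingEnd ℂ (𝓕 φ ξ) := by
    intro ξ
    rw [fourier_coe, fourier_coe, Real.fourier_eq, Real.fourier_eq, ← integral_conj,
      ← integral_neg_eq_self]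
    refine integral_congr_ae (.of_forall fun x => ?_)
    simp only [hφ', neg_neg, inner_neg_left, Circle.smul_def, smul_eq_mul, map_mul]
    congr 1
    rw [← Circle.coe_inv_eq_conj, ← AddChar.map_neg_eq_inv, neg_neg]
  refine ⟨SchwartzMap.convolution (ContinuousLinearMap.mul ℂ ℂ) φ φ', fun ξ => ?_, ?_⟩
  · rw [fourier_convolution, pairing_apply_apply, ContinuousLinearMap.mul_apply', hF,
      Complex.mul_conj, Complex.normSq_eq_norm_sq]
  · have hpE : ENNReal.ofReal p ≠ 0 := by simpa
    have hsE : ENNReal.ofReal s ≠ 0 := by simpa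
    have hS := eLpNorm_rpow_eq_lintegral (μ := volume) hsE ENNReal.ofReal_ne_top φ
    rw [ENNReal.toReal_ofReal hs0.le] at hS
    have hP := eLpNorm_rpow_eq_lintegral (μ := volume) hpE ENNReal.ofReal_ne_top
      (SchwartzMap.convolution (ContinuousLinearMap.mul ℂ ℂ) φ φ')
    rw [ENNReal.toReal_ofReal hp0.le] at hP
    rw [← ENNReal.rpow_le_rpow_iff hp0, hP]
    have hu : Measurable fun x => ‖φ x‖ₑ := φ.continuous.enorm.measurable
    have hv : Measurable fun x => ‖φ' x‖ₑ := φ'.continuous.enorm.measurable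
    calc _ ≤ ∫⁻ x, (∫⁻ y, ‖φ y‖ₑ * ‖φ' (x - y)‖ₑ) ^ p := by
          gcongr with x
          rw [convolution_apply, MeasureTheory.convolution_def]
          refine (enorm_integral_le_lintegral_enorm _).trans_eq (lintegral_congr fun y => ?_)
          rw [ContinuousLinearMap.mul_apply', enorm_mul]
      _ ≤ ((∫⁻ x, ‖φ x‖ₑ ^ s) * ∫⁻ x, ‖φ' x‖ₑ ^ s) ^ (p / s) :=
          lintegral_convolution_rpow_le hu hv hs hsp h
      _ = ((∫⁻ x, ‖φ x‖ₑ ^ s) * ∫⁻ x, ‖φ x‖ₑ ^ s) ^ (p / s) := by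
          congr 2
          rw [← lintegral_neg_eq_self (fun x => ‖φ x‖ₑ ^ s)]
          refine lintegral_congr fun x => ?_
          rw [hφ', RCLike.enorm_conj]
      _ = _ := by
          rw [← hS, ← ENNReal.rpow_add_of_nonneg _ _ hs0.le hs0.le, ← ENNReal.rpow_mul,
            ← ENNReal.rpow_natCast, ← ENNReal.rpow_mul]
          congr 1
          field_simp
          push_cast
          ring

end Young

/-! ### Exponent arithmetic and the Hausdorff-Young inequality. -/

section Exponents

theorem conjExponent_ofReal {s : ℝ} (hs : 1 < s) :
    (ENNReal.ofReal s).conjExponent = ENNReal.ofReal (s / (s - 1)) := by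
  have h : 0 < s - 1 := by linarith
  rw [ENNReal.conjExponent, ← ENNReal.ofReal_one, ← ENNReal.ofReal_sub _ zero_le_one,
    ← ENNReal.ofReal_inv_of_pos h, ← ENNReal.ofReal_add zero_le_one (by positivity)]
  congr 1
  field_simp
  ring

theorem conjExponent_one : (1 : ℝ≥0∞).conjExponent = ∞ := by simp [ENNReal.conjExponent]

variable {d : ℕ} {ν : Measure (EuclideanSpace ℝ (Fin d))}

theorem exponent_eq_ofReal {s p q : ℝ} (hs : 1 < s) (hp : 1 < p) (hq : 0 < q) :
    ENNReal.ofReal q * (ENNReal.ofReal s).conjExponent / (ENNReal.ofReal p).conjExponent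
      = ENNReal.ofReal (q * (s / (s - 1)) / (p / (p - 1))) := by
  have h1 : 0 < s - 1 := by linarith
  have h2 : 0 < p - 1 := by linarith
  rw [conjExponent_ofReal hs, conjExponent_ofReal hp, ← ENNReal.ofReal_mul hq.le,
    ← ENNReal.ofReal_div_of_pos (by positivity)]

/-- The case `s = p` is separate: the target exponent is then `q` itself, and the interpolation
constants require `s < p`. -/
theorem APrioriEstimate.of_le {s p q : ℝ} (hs : 1 < s) (hsp : s ≤ p) (hpq : p ≤ q)
    (h : APrioriEstimate ν (ENNReal.ofReal p) (ENNReal.ofReal q)) :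
    APrioriEstimate ν (ENNReal.ofReal s) (ENNReal.ofReal (q * (s / (s - 1)) / (p / (p - 1)))) := by
  rcases hsp.eq_or_lt with rfl | hlt
  · have h1 : 0 < s - 1 := by linarith
    rwa [mul_div_cancel_right₀ _ (by positivity)]
  · obtain ⟨C, hC⟩ := h
    exact exists_eLpNorm_fourier_le_of_lt hs hlt hpq hC rfl

/-- Conjugate exponents decrease, so the target exponent is at least `q`. In particular it exceeds
`s` when `p < q`, as Christ-Kiselev requires. -/
theorem le_exponent {s p q : ℝ} (hs : 1 < s) (hsp : s ≤ p) (hpq : p ≤ q) :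
    q ≤ q * (s / (s - 1)) / (p / (p - 1)) := by
  have h1 : 0 < s - 1 := by linarith
  have h2 : 0 < p - 1 := by linarith
  have h3 : 0 < p := by linarith
  have h4 : p / (p - 1) ≤ s / (s - 1) := by
    rw [div_le_div_iff₀ h2 h1]; linarith
  rw [le_div_iff₀ (by positivity)]
  gcongr
  linarith

theorem aPrioriEstimate_two : APrioriEstimate (volume : Measure (EuclideanSpace ℝ (Fin d))) 2 2 := by
  refine ⟨1, fun φ => ?_⟩
  have h1 : ‖(𝓕 φ).toLp 2 volume‖ₑ = ‖φ.toLp 2 volume‖ₑ := by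
    rw [← ofReal_norm, ← ofReal_norm, norm_fourier_toL2_eq]
  rw [Lp.enorm_def, Lp.enorm_def, eLpNorm_congr_ae ((𝓕 φ).coeFn_toLp 2 volume),
    eLpNorm_congr_ae (φ.coeFn_toLp 2 volume)] at h1
  rw [h1, ENNReal.coe_one, one_mul]

/-- The Hausdorff-Young inequality for Schwartz functions. -/
theorem aPrioriEstimate_conjExponent {s : ℝ≥0∞} (hs : 1 ≤ s) (hs2 : s ≤ 2) :
    APrioriEstimate (volume : Measure (EuclideanSpace ℝ (Fin d))) s s.conjExponent := by
  rcases hs.eq_or_lt with rfl | hs1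
  · rw [conjExponent_one]
    exact aPrioriEstimate_one_top _
  · have hs_fin : s ≠ ∞ := ne_top_of_le_ne_top (by simp) hs2
    lift s to ℝ≥0 using hs_fin
    rw [← ENNReal.ofReal_coe_nnreal] at hs1 hs2 ⊢
    rw [← ENNReal.ofReal_one, ENNReal.ofReal_lt_ofReal_iff_of_nonneg zero_le_one] at hs1
    have h2 : (2 : ℝ≥0∞) = ENNReal.ofReal 2 := by simp
    rw [h2, ENNReal.ofReal_le_ofReal_iff (by norm_num)] at hs2
    have h22 : APrioriEstimate (volume : Measure (EuclideanSpace ℝ (Fin d)))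
        (ENNReal.ofReal 2) (ENNReal.ofReal 2) := by
      rw [← h2]
      exact aPrioriEstimate_two
    have h3 := h22.of_le hs1 hs2 le_rfl
    rw [conjExponent_ofReal hs1]
    convert h3 using 2
    ring

end Exponents

/-! ### The distributional Fourier transform as a function. -/

section GivenBy

variable {d : ℕ}

theorem IsGivenBy.congr {u : 𝓢'(EuclideanSpace ℝ (Fin d), ℂ)}
    {F G : EuclideanSpace ℝ (Fin d) → ℂ} (h : IsGivenBy u F) (hFG : F =ᵐ[volume] G) :
    IsGivenBy u G where
  locallyIntegrable := by
    intro x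
    obtain ⟨U, hU, hUF⟩ := h.locallyIntegrable x
    exact ⟨U, hU, hUF.congr (ae_restrict_of_ae hFG)⟩
  integrable φ := (h.integrable φ).congr (hFG.mono fun x hx => by simp [hx])
  apply_eq φ := (h.apply_eq φ).trans (integral_congr_ae (hFG.mono fun x hx => by simp [hx]))

/-- A restriction operator for Lebesgue measure represents the distributional Fourier transform. -/
theorem IsRestrictionOperator.isGivenBy {s t : ℝ≥0∞} [Fact (1 ≤ s)] (hs : s ≠ ∞) (ht : 1 ≤ t)
    {R : Lp ℂ s (volume : Measure (EuclideanSpace ℝ (Fin d))) →ₗ[ℂ]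
      Lp ℂ t (volume : Measure (EuclideanSpace ℝ (Fin d)))}
    (hR : IsRestrictionOperator volume s t R)
    (f : Lp ℂ s (volume : Measure (EuclideanSpace ℝ (Fin d)))) :
    IsGivenBy (fourierLp f) (R f) := by
  have : Fact (1 ≤ t) := ⟨ht⟩
  refine ⟨(Lp.memLp (R f)).locallyIntegrable ht, fun φ => ?_, fun φ => ?_⟩
  · exact (integrable_mul_schwartz ht (Lp.memLp (R f)) φ).congr
      (.of_forall fun x => mul_comm _ _)
  · obtain ⟨C, hC⟩ := hR.bounded
    let R' := R.mkContinuous C hC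
    have h1 : Continuous fun f => fourierLp f φ :=
      (PointwiseConvergenceCLM.evalCLM (RingHom.id ℂ) ℂ (𝓕 φ)).continuous.comp
        (Lp.toTemperedDistributionCLM ℂ volume s).continuous
    have h2 : Continuous fun f => Lp.toTemperedDistribution (R f) φ :=
      ((PointwiseConvergenceCLM.evalCLM (RingHom.id ℂ) ℂ φ).continuous.comp
        (Lp.toTemperedDistributionCLM ℂ volume t).continuous).comp R'.continuous
    -- Tested against `φ`, both distributions depend continuously on `f`, and they agree on the
    -- dense set of Schwartz functions.
    have h3 := (denseRange_toLpCLM (E := EuclideanSpace ℝ (Fin d)) (F := ℂ)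
      (μ := volume) hs).equalizer h1 h2 (funext fun ψ => by
        simp only [Function.comp_apply, toLpCLM_apply, fourierLp,
          Lp.toTemperedDistribution_toLp_eq, TemperedDistribution.fourier_toTemperedDistributionCLM_eq,
          toTemperedDistributionCLM_apply_apply, Lp.toTemperedDistribution_apply]
        refine integral_congr_ae ?_
        filter_upwards [hR.eq_fourier ψ] with x hx
        rw [hx])
    have h4 := congrFun h3 f
    simp only [Lp.toTemperedDistribution_apply, smul_eq_mul] at h4
    exact h4

end GivenBy

end FourierRestriction

namespace FourierRestriction

/-! ### Averages over ellipsoids. -/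

section Ellipsoid

variable {d : ℕ}

theorem ellipsoid_eq_preimage (r : PosParam d) (ξ : EuclideanSpace ℝ (Fin d)) :
    ellipsoid r ξ
      = ((Homeomorph.subRight ξ).trans (scaling r).toHomeomorph) ⁻¹' Metric.closedBall 0 1 := by
  ext η
  rw [Set.mem_preimage, mem_closedBall_zero_iff, ← sq_le_one_iff₀ (norm_nonneg _),
    EuclideanSpace.norm_sq_eq]
  change ∑ j, (η j - ξ j) ^ 2 / r.1 j ^ 2 ≤ 1 ↔ ∑ j, ‖(η j - ξ j) / r.1 j‖ ^ 2 ≤ 1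
  simp only [Real.norm_eq_abs, sq_abs, div_pow]

theorem isCompact_ellipsoid (r : PosParam d) (ξ : EuclideanSpace ℝ (Fin d)) :
    IsCompact (ellipsoid r ξ) := by
  rw [ellipsoid_eq_preimage, Homeomorph.isCompact_preimage]
  exact isCompact_closedBall 0 1

theorem measurableSet_ellipsoid (r : PosParam d) (ξ : EuclideanSpace ℝ (Fin d)) :
    MeasurableSet (ellipsoid r ξ) := (isCompact_ellipsoid r ξ).measurableSet

theorem volume_ellipsoid (r : PosParam d) (ξ : EuclideanSpace ℝ (Fin d)) :
    volume (ellipsoid r ξ) = ENNReal.ofReal (∏ j, r.1 j)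
      * volume (Metric.closedBall (0 : EuclideanSpace ℝ (Fin d)) 1) := by
  have h1 : ellipsoid r ξ = (fun η => η - ξ) ⁻¹' (scaling r ⁻¹' Metric.closedBall 0 1) :=
    ellipsoid_eq_preimage r ξ
  rw [h1, (measurePreserving_sub_right volume ξ).measure_preimage
      ((scaling r).continuous.measurable measurableSet_closedBall).nullMeasurableSet,
    ← Measure.map_apply (scaling r).continuous.measurable measurableSet_closedBall,
    map_scaling_volume, Measure.smul_apply, smul_eq_mul]

theorem volume_ellipsoid_ne_zero (r : PosParam d) (ξ : EuclideanSpace ℝ (Fin d)) :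
    volume (ellipsoid r ξ) ≠ 0 := by
  rw [volume_ellipsoid]
  refine mul_ne_zero ?_ (Metric.measure_closedBall_pos volume _ one_pos).ne'
  simpa using Finset.prod_pos fun j _ => r.2 j

theorem volume_ellipsoid_ne_top (r : PosParam d) (ξ : EuclideanSpace ℝ (Fin d)) :
    volume (ellipsoid r ξ) ≠ ∞ := (isCompact_ellipsoid r ξ).measure_lt_top.ne

/-- The normalised Lebesgue measure on an ellipsoid is a probability measure. -/
theorem isProbabilityMeasure_ellipsoid (r : PosParam d) (ξ : EuclideanSpace ℝ (Fin d)) :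
    IsProbabilityMeasure ((volume.restrict (ellipsoid r ξ) Set.univ)⁻¹ •
      volume.restrict (ellipsoid r ξ)) := by
  refine ⟨?_⟩
  rw [Measure.smul_apply, Measure.restrict_apply_univ, smul_eq_mul,
    ENNReal.inv_mul_cancel (volume_ellipsoid_ne_zero r ξ) (volume_ellipsoid_ne_top r ξ)]

/-- Averages over ellipsoids are controlled by `L^t` norms. -/
theorem exists_laverage_ellipsoid_le_eLpNorm (r : PosParam d) (ξ : EuclideanSpace ℝ (Fin d))
    {t : ℝ≥0∞} (ht : 1 ≤ t) : ∃ C : ℝ≥0∞, C ≠ ∞ ∧ ∀ F : EuclideanSpace ℝ (Fin d) → ℂ,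
      AEStronglyMeasurable F volume →
        ⨍⁻ η in ellipsoid r ξ, ‖F η‖ₑ ∂volume ≤ C * eLpNorm F t volume := by
  have := isProbabilityMeasure_ellipsoid r ξ
  have hc : (volume.restrict (ellipsoid r ξ) Set.univ)⁻¹ ≠ ∞ := by
    simpa using volume_ellipsoid_ne_zero r ξ
  refine ⟨(volume.restrict (ellipsoid r ξ) Set.univ)⁻¹ ^ (1 / t).toReal,
    ENNReal.rpow_ne_top_of_nonneg (by positivity) hc, fun F hF => ?_⟩
  rw [laverage, ← eLpNorm_one_eq_lintegral_enorm]
  have h1 := hF.restrict (s := ellipsoid r ξ)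
  refine (eLpNorm_le_eLpNorm_of_exponent_le ht (h1.smul_measure _)).trans ?_
  refine (eLpNorm_smul_measure_le _ _ _ _).trans ?_
  rw [smul_eq_mul]
  gcongr
  exact Measure.restrict_le_self

theorem sq_laverage_ellipsoid_le (r : PosParam d) (ξ : EuclideanSpace ℝ (Fin d))
    {F : EuclideanSpace ℝ (Fin d) → ℂ} (hF : AEStronglyMeasurable F volume) :
    (⨍⁻ η in ellipsoid r ξ, ‖F η‖ₑ ∂volume) ^ 2 ≤ ⨍⁻ η in ellipsoid r ξ, ‖F η‖ₑ ^ 2 ∂volume := by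
  have := isProbabilityMeasure_ellipsoid r ξ
  have h1 := eLpNorm_le_eLpNorm_of_exponent_le one_le_two
    ((hF.restrict (s := ellipsoid r ξ)).smul_measure
      (volume.restrict (ellipsoid r ξ) Set.univ)⁻¹)
  have h2 := eLpNorm_rpow_eq_lintegral
    (μ := (volume.restrict (ellipsoid r ξ) Set.univ)⁻¹ • volume.restrict (ellipsoid r ξ))
    two_ne_zero ENNReal.ofNat_ne_top F
  rw [eLpNorm_one_eq_lintegral_enorm] at h1
  have h3 := pow_le_pow_left₀ zero_le h1 2
  rw [laverage, laverage]
  simp only [ENNReal.toReal_ofNat, ENNReal.rpow_ofNat] at h2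
  rwa [h2] at h3

/-- The ellipsoid lies in the Euclidean ball of radius `max_j r_j`, so it shrinks to its centre
however eccentric it is. -/
theorem tendsto_laverage_ellipsoid_of_continuousAt {F : EuclideanSpace ℝ (Fin d) → ℂ}
    {ξ : EuclideanSpace ℝ (Fin d)} (hF : ContinuousAt F ξ) :
    Tendsto (fun r => ⨍⁻ η in ellipsoid r ξ, ‖F η - F ξ‖ₑ ∂volume) (toZero d) (𝓝 0) := by
  rw [ENNReal.tendsto_nhds_zero]
  intro ε hε
  have h1 : ∀ᶠ η in 𝓝 ξ, ‖F η - F ξ‖ₑ ≤ ε := by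
    have : Tendsto (fun η => ‖F η - F ξ‖ₑ) (𝓝 ξ) (𝓝 0) := by
      have := (hF.sub (continuousAt_const (y := F ξ))).enorm
      simpa [ContinuousAt] using this
    exact (ENNReal.tendsto_nhds_zero.1 this) ε hε
  obtain ⟨δ, hδ, hball⟩ := Metric.eventually_nhds_iff_ball.1 h1
  have h2 : ∀ᶠ r in toZero d, ellipsoid r ξ ⊆ Metric.ball ξ δ := by
    have h3 : ∀ᶠ v : Fin d → ℝ in 𝓝 0, ‖v‖ < δ := by
      filter_upwards [Metric.ball_mem_nhds (0 : Fin d → ℝ) hδ] with v hv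
      exact mem_ball_zero_iff.1 hv
    refine (h3.comap _).mono fun r hr η hη => ?_
    rw [mem_ball_iff_norm]
    refine lt_of_le_of_lt ?_ hr
    rw [← sq_le_sq₀ (norm_nonneg _) (norm_nonneg _), EuclideanSpace.norm_sq_eq]
    have h4 : ∑ j, (η j - ξ j) ^ 2 / r.1 j ^ 2 ≤ 1 := hη
    calc ∑ j, ‖(η - ξ) j‖ ^ 2
        ≤ ∑ j, ‖(r : Fin d → ℝ)‖ ^ 2 * ((η j - ξ j) ^ 2 / r.1 j ^ 2) := by
          refine Finset.sum_le_sum fun j _ => ?_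
          have h5 : r.1 j ^ 2 ≤ ‖(r : Fin d → ℝ)‖ ^ 2 := by
            have := norm_le_pi_norm (r : Fin d → ℝ) j
            rw [Real.norm_of_nonneg (r.2 j).le] at this
            exact pow_le_pow_left₀ (r.2 j).le this 2
          have h6 := r.2 j
          rw [Real.norm_eq_abs, sq_abs, ← mul_div_assoc, le_div_iff₀ (by positivity), mul_comm]
          exact mul_le_mul_of_nonneg_right h5 (sq_nonneg _)
      _ ≤ ‖(r : Fin d → ℝ)‖ ^ 2 := by
          rw [← Finset.mul_sum]
          exact mul_le_of_le_one_right (sq_nonneg _) h4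
  filter_upwards [h2] with r hr
  rw [setLAverage_eq, ENNReal.div_le_iff (volume_ellipsoid_ne_zero r ξ)
    (volume_ellipsoid_ne_top r ξ)]
  refine (setLIntegral_mono' (measurableSet_ellipsoid r ξ)
    fun η hη => hball η (hr hη)).trans_eq ?_
  rw [setLIntegral_const]

end Ellipsoid

/-! ### Domination of averages of `|φ̂|` by the smooth maximal function. -/

section Averages

theorem enorm_complex_ofReal (x : ℝ) : ‖(x : ℂ)‖ₑ = ‖x‖ₑ := by
  rw [← ofReal_norm, Complex.norm_real, ofReal_norm]

variable {d : ℕ}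

theorem conv_fourierLp_toLp {p : ℝ≥0∞} [Fact (1 ≤ p)] (η φ : 𝓢(EuclideanSpace ℝ (Fin d), ℂ))
    (ξ : EuclideanSpace ℝ (Fin d)) :
    conv (fourierLp (η.toLp p volume)) φ ξ = ∫ y, φ (ξ - y) * 𝓕 η y := by
  rw [conv, fourierLp, Lp.toTemperedDistribution_toLp_eq,
    TemperedDistribution.fourier_toTemperedDistributionCLM_eq]
  simp only [toTemperedDistributionCLM_apply_apply, reflectAt_apply, smul_eq_mul]

/-- For Schwartz functions with non-negative Fourier transform, the averages of the Fourier
transform over ellipsoids are dominated by a smooth maximal function. -/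
theorem exists_laverage_ellipsoid_le_conv (d : ℕ) :
    ∃ χ : 𝓢(EuclideanSpace ℝ (Fin d), ℂ), ∀ (p : ℝ≥0∞) [Fact (1 ≤ p)]
      (η : 𝓢(EuclideanSpace ℝ (Fin d), ℂ)) (w : EuclideanSpace ℝ (Fin d) → ℝ),
      (∀ y, 0 ≤ w y) → (∀ y, 𝓕 η y = (w y : ℂ)) →
      ∀ (r : PosParam d) (ξ : EuclideanSpace ℝ (Fin d)),
        ⨍⁻ y in ellipsoid r ξ, ‖𝓕 η y‖ₑ ∂volume
          ≤ (volume (Metric.closedBall (0 : EuclideanSpace ℝ (Fin d)) 1))⁻¹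
            * ‖conv (fourierLp (η.toLp p volume)) (dilate χ r) ξ‖ₑ := by
  let β : ContDiffBump (0 : EuclideanSpace ℝ (Fin d)) :=
    { rIn := 1, rOut := 2, rIn_pos := one_pos, rIn_lt_rOut := one_lt_two }
  have h1 : ContDiff ℝ (⊤ : ℕ∞) fun x => (β x : ℂ) :=
    (Complex.ofRealCLM.contDiff (n := (⊤ : ℕ∞))).comp (β.contDiff (n := ⊤))
  have h2 : HasCompactSupport fun x => (β x : ℂ) :=
    HasCompactSupport.comp_left (g := ((↑) : ℝ → ℂ)) β.hasCompactSupport Complex.ofReal_zero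
  refine ⟨h2.toSchwartzMap h1, fun p _ η w hw hη r ξ => ?_⟩
  set χ := h2.toSchwartzMap h1 with hχ
  have hP : 0 < ∏ j, r.1 j := Finset.prod_pos fun j _ => r.2 j
  have hdil : ∀ x, dilate χ r x = (((∏ j, r.1 j)⁻¹ * β (scaling r x) : ℝ) : ℂ) := by
    intro x
    rw [Complex.ofReal_mul, ← Complex.real_smul]
    rfl
  have hprod : ∀ y, dilate χ r (ξ - y) * 𝓕 η y
      = (((∏ j, r.1 j)⁻¹ * β (scaling r (ξ - y)) * w y : ℝ) : ℂ) := by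
    intro y
    rw [hdil, hη, ← Complex.ofReal_mul]
  have hnn : ∀ y, 0 ≤ (∏ j, r.1 j)⁻¹ * β (scaling r (ξ - y)) * w y := fun y =>
    mul_nonneg (mul_nonneg (inv_nonneg.2 hP.le) β.nonneg) (hw y)
  have hint : Integrable fun y => (∏ j, r.1 j)⁻¹ * β (scaling r (ξ - y)) * w y := by
    have h3 : Integrable fun y => dilate χ r (ξ - y) * 𝓕 η y :=
      ((integrable_mul_schwartz le_rfl (memLp_one_iff_integrable.2 (𝓕 η).integrable)
        (reflectAt (dilate χ r) ξ))).congr (.of_forall fun y => by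
          rw [Pi.mul_apply, reflectAt_apply, mul_comm])
    simp only [hprod] at h3
    exact h3.re
  rw [conv_fourierLp_toLp]
  simp only [hprod]
  rw [integral_complex_ofReal, enorm_complex_ofReal, Real.enorm_of_nonneg (integral_nonneg hnn),
    ofReal_integral_eq_lintegral_ofReal hint (.of_forall hnn), setLAverage_eq, volume_ellipsoid,
    ENNReal.div_eq_inv_mul, ENNReal.mul_inv (.inl (by simpa using hP)) (.inl ENNReal.ofReal_ne_top),
    mul_comm (ENNReal.ofReal _)⁻¹, mul_assoc]
  gcongr
  rw [← lintegral_const_mul' _ _ (by simpa using hP)]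
  refine le_trans ?_ (setLIntegral_le_lintegral (ellipsoid r ξ) _)
  refine setLIntegral_mono' (measurableSet_ellipsoid r ξ) fun y hy => ?_
  rw [ellipsoid_eq_preimage, Set.mem_preimage, mem_closedBall_zero_iff] at hy
  -- The bump equals `1` on the unit ball, hence its dilate equals `(∏ r_j)⁻¹` on the ellipsoid.
  -- Since `w ≥ 0`, the rest of the convolution integral may be dropped.
  have h5 : β (scaling r (ξ - y)) = 1 := by
    refine β.one_of_mem_closedBall ?_
    rw [mem_closedBall_zero_iff, ← neg_sub, map_neg, norm_neg]
    exact hy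
  rw [h5, mul_one, ENNReal.ofReal_mul (inv_nonneg.2 hP.le), ENNReal.ofReal_inv_of_pos hP, hη,
    enorm_complex_ofReal, Real.enorm_of_nonneg (hw y)]

variable {ν : Measure (EuclideanSpace ℝ (Fin d))}

/-- The maximal averages of the Fourier transform over ellipsoids, for Schwartz functions. -/
theorem exists_laverage_fourier_le {s p q : ℝ} (hs : 1 ≤ s) (hsp : s ≤ p) (hpq : p < q)
    (h : 2 / s = 1 + 1 / p) (hest : APrioriEstimate ν (ENNReal.ofReal p) (ENNReal.ofReal q)) :
    ∃ K : ℝ≥0, ∀ φ : 𝓢(EuclideanSpace ℝ (Fin d), ℂ), ∃ G : EuclideanSpace ℝ (Fin d) → ℝ≥0∞,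
      Measurable G ∧ (∀ r ξ, ⨍⁻ y in ellipsoid r ξ, ‖𝓕 φ y‖ₑ ∂volume ≤ G ξ) ∧
      eLpNorm G (ENNReal.ofReal (2 * q)) ν ≤ K * eLpNorm φ (ENNReal.ofReal s) volume := by
  obtain ⟨χ, hχ⟩ := exists_laverage_ellipsoid_le_conv d
  have hp1 : Fact (1 ≤ ENNReal.ofReal p) := ⟨by simpa using hs.trans hsp⟩
  have hq0 : 0 < q := by linarith
  have hqE : ENNReal.ofReal q ≠ 0 := by simpa
  have h2qE : ENNReal.ofReal (2 * q) ≠ 0 := by simpa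
  obtain ⟨K, hK⟩ := exists_eLpNorm_maximalFunction_le
    ((ENNReal.ofReal_lt_ofReal_iff hq0).2 hpq) ENNReal.ofReal_ne_top hest χ
  set c := (volume (Metric.closedBall (0 : EuclideanSpace ℝ (Fin d)) 1))⁻¹ with hc
  have hctop : c ≠ ∞ := by
    simpa [hc] using (Metric.measure_closedBall_pos volume (0 : EuclideanSpace ℝ (Fin d)) one_pos).ne'
  refine ⟨((c * K) ^ (1 / 2 : ℝ)).toNNReal, fun φ => ?_⟩
  obtain ⟨η, hη, hηn⟩ := exists_fourier_eq_norm_sq φ hs hsp h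
  set M := maximalFunction (fourierLp (η.toLp (ENNReal.ofReal p) volume)) χ with hM
  -- `M` bounds averages of `|φ̂|²`, so its square root bounds averages of `|φ̂|`; this is why the
  -- exponent doubles to `2q` and the constant is a square root.
  refine ⟨fun ξ => (c * M ξ) ^ (1 / 2 : ℝ),
    ((measurable_maximalFunction _ χ).const_mul c).pow_const _, fun r ξ => ?_, ?_⟩
  · rw [one_div, ENNReal.le_rpow_inv_iff two_pos, ENNReal.rpow_ofNat]
    calc (⨍⁻ y in ellipsoid r ξ, ‖𝓕 φ y‖ₑ ∂volume) ^ 2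
        ≤ ⨍⁻ y in ellipsoid r ξ, ‖𝓕 φ y‖ₑ ^ 2 ∂volume :=
          sq_laverage_ellipsoid_le r ξ (𝓕 φ).continuous.aestronglyMeasurable
      _ = ⨍⁻ y in ellipsoid r ξ, ‖𝓕 η y‖ₑ ∂volume := by
          congr 1
          funext y
          rw [hη, enorm_complex_ofReal, enorm_pow, enorm_norm]
      _ ≤ c * ‖conv (fourierLp (η.toLp (ENNReal.ofReal p) volume)) (dilate χ r) ξ‖ₑ :=
          hχ _ η (fun y => ‖𝓕 φ y‖ ^ 2) (fun y => by positivity) hη r ξ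
      _ ≤ c * M ξ := by
          gcongr
          exact enorm_conv_le_maximalFunction _ _ _ _
  · rw [ENNReal.coe_toNNReal (ENNReal.rpow_ne_top_of_nonneg (by norm_num)
      (ENNReal.mul_ne_top hctop ENNReal.coe_ne_top)),
      ← ENNReal.rpow_le_rpow_iff (z := 2 * q) (by positivity)]
    have e1 := eLpNorm_rpow_eq_lintegral (μ := ν) h2qE ENNReal.ofReal_ne_top
      (fun ξ => (c * M ξ) ^ (1 / 2 : ℝ))
    have e2 := eLpNorm_rpow_eq_lintegral (μ := ν) hqE ENNReal.ofReal_ne_top (fun ξ => c * M ξ)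
    rw [ENNReal.toReal_ofReal (by positivity)] at e1 e2
    have e3 : ∀ x : ℝ≥0∞, (x ^ (1 / 2 : ℝ)) ^ (2 * q) = x ^ q := fun x => by
      rw [← ENNReal.rpow_mul]; congr 1; ring
    simp only [enorm_eq_self, e3] at e1 e2
    rw [e1, ← e2, eLpNorm_const_mul_ennreal hqE ENNReal.ofReal_ne_top hctop,
      ENNReal.mul_rpow_of_nonneg _ _ (by positivity : (0 : ℝ) ≤ 2 * q), e3,
      ENNReal.rpow_mul (eLpNorm φ _ _), ENNReal.rpow_ofNat,
      ← ENNReal.mul_rpow_of_nonneg _ _ hq0.le, mul_assoc]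
    refine ENNReal.rpow_le_rpow ?_ hq0.le
    gcongr
    refine (hK _).trans ?_
    gcongr
    rw [eLpNorm_congr_ae (η.coeFn_toLp _ volume)]
    exact hηn

end Averages

end FourierRestriction

namespace FourierRestriction

/-! ### Lebesgue points with respect to ellipsoids. -/

section LebesguePoints

variable {d : ℕ} {ν : Measure (EuclideanSpace ℝ (Fin d))} {s t : ℝ≥0∞}

theorem laverage_ellipsoid_le_add (r : PosParam d) (ξ : EuclideanSpace ℝ (Fin d))
    {a b c : EuclideanSpace ℝ (Fin d) → ℝ≥0∞} (hb : Measurable b)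
    (h : ∀ᵐ η ∂(volume : Measure (EuclideanSpace ℝ (Fin d))), a η ≤ b η + c η) :
    ⨍⁻ η in ellipsoid r ξ, a η ∂volume
      ≤ ⨍⁻ η in ellipsoid r ξ, b η ∂volume + ⨍⁻ η in ellipsoid r ξ, c η ∂volume := by
  rw [laverage, laverage, laverage, ← lintegral_add_left hb]
  exact lintegral_mono_ae (Measure.ae_smul_measure (ae_restrict_of_ae h) _)

/-- The maximal averages over ellipsoids of the Hausdorff-Young extension. -/
theorem IsRestrictionOperator.exists_laverage_le [Fact (1 ≤ s)] (hs : s ≠ ∞) (ht : t ≠ 0)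
    (ht' : t ≠ ∞)
    {R₀ : Lp ℂ s (volume : Measure (EuclideanSpace ℝ (Fin d))) →ₗ[ℂ]
      Lp ℂ s.conjExponent (volume : Measure (EuclideanSpace ℝ (Fin d)))}
    (hR₀ : IsRestrictionOperator volume s s.conjExponent R₀) {K : ℝ≥0}
    (hK : ∀ φ : 𝓢(EuclideanSpace ℝ (Fin d), ℂ), ∃ G : EuclideanSpace ℝ (Fin d) → ℝ≥0∞,
      Measurable G ∧ (∀ r ξ, ⨍⁻ y in ellipsoid r ξ, ‖𝓕 φ y‖ₑ ∂volume ≤ G ξ) ∧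
      eLpNorm G t ν ≤ K * eLpNorm φ s volume)
    (g : Lp ℂ s (volume : Measure (EuclideanSpace ℝ (Fin d)))) :
    ∃ G : EuclideanSpace ℝ (Fin d) → ℝ≥0∞, Measurable G ∧
      (∀ r ξ, ⨍⁻ y in ellipsoid r ξ, ‖R₀ g y‖ₑ ∂volume ≤ G ξ) ∧
      eLpNorm G t ν ≤ K * eLpNorm g s volume := by
  obtain ⟨φ, hφ⟩ := exists_schwartz_tendsto_Lp hs g
  obtain ⟨C, hC⟩ := hR₀.exists_eLpNorm_le
  choose G hGm hG hGn using fun n => hK (φ n)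
  refine ⟨fun ξ => liminf (fun n => G n ξ) atTop, Measurable.liminf hGm, fun r ξ => ?_, ?_⟩
  -- The constant `c` depends on `r` and `ξ`, which is harmless: they stay fixed while `n → ∞`, and
  -- the uniform bound comes from `G n`.
  · obtain ⟨c, hc, hcF⟩ := exists_laverage_ellipsoid_le_eLpNorm r ξ
      (t := s.conjExponent) le_self_add
    have hlim : Tendsto (fun n => c * (C * eLpNorm (g - (φ n).toLp s volume :
        Lp ℂ s (volume : Measure (EuclideanSpace ℝ (Fin d)))) s volume)) atTop (𝓝 0) := by
      simpa using ENNReal.Tendsto.const_mul (tendsto_enorm_sub_schwartz hφ C) (Or.inr hc)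
    dsimp only
    rw [← ENNReal.liminf_add_of_right_tendsto_zero hlim]
    refine le_liminf_of_le (by isBoundedDefault) (.of_forall fun n => ?_)
    refine (laverage_ellipsoid_le_add r ξ (b := fun y => ‖𝓕 (φ n) y‖ₑ)
      (c := fun y => ‖R₀ (g - (φ n).toLp s volume) y‖ₑ)
      (𝓕 (φ n)).continuous.enorm.measurable ?_).trans ?_
    · filter_upwards [hR₀.ae_eq_fourier_sub g (φ n)] with y hy
      rw [hy]
      refine le_trans (le_of_eq ?_) (enorm_add_le _ _)
      congr 1
      ring
    · refine add_le_add (hG n r ξ) ((hcF _ (Lp.aestronglyMeasurable _)).trans ?_)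
      exact mul_le_mul' le_rfl (hC _)
  · refine (eLpNorm_le_liminf_eLpNorm ht ht' hGm (.of_forall fun _ => le_rfl)).trans ?_
    have h1 : Tendsto (fun n => K * eLpNorm (φ n) s volume) atTop (𝓝 (K * eLpNorm g s volume)) := by
      refine ENNReal.Tendsto.const_mul ?_ (Or.inr ENNReal.coe_ne_top)
      have h2 := hφ.enorm
      simp only [Lp.enorm_def] at h2
      exact h2.congr fun n => eLpNorm_congr_ae ((φ n).coeFn_toLp s volume)
    exact (liminf_le_liminf (.of_forall hGn)).trans_eq h1.liminf_eq

/-- Almost every point is a Lebesgue point with respect to ellipsoids. -/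
theorem IsRestrictionOperator.ae_tendsto_laverage [Fact (1 ≤ s)] (hs : s ≠ ∞) (ht : 1 ≤ t)
    (ht' : t ≠ ∞)
    {R : Lp ℂ s (volume : Measure (EuclideanSpace ℝ (Fin d))) →ₗ[ℂ] Lp ℂ t ν}
    (hR : IsRestrictionOperator ν s t R)
    {R₀ : Lp ℂ s (volume : Measure (EuclideanSpace ℝ (Fin d))) →ₗ[ℂ]
      Lp ℂ s.conjExponent (volume : Measure (EuclideanSpace ℝ (Fin d)))}
    (hR₀ : IsRestrictionOperator volume s s.conjExponent R₀) {K : ℝ≥0}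
    (hK : ∀ φ : 𝓢(EuclideanSpace ℝ (Fin d), ℂ), ∃ G : EuclideanSpace ℝ (Fin d) → ℝ≥0∞,
      Measurable G ∧ (∀ r ξ, ⨍⁻ y in ellipsoid r ξ, ‖𝓕 φ y‖ₑ ∂volume ≤ G ξ) ∧
      eLpNorm G t ν ≤ K * eLpNorm φ s volume)
    (f : Lp ℂ s (volume : Measure (EuclideanSpace ℝ (Fin d)))) :
    ∀ᵐ ξ ∂ν, Tendsto (fun r => ⨍⁻ η in ellipsoid r ξ, ‖R₀ f η - R f ξ‖ₑ ∂volume)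
      (toZero d) (𝓝 0) := by
  have ht0 : t ≠ 0 := (zero_lt_one.trans_le ht).ne'
  obtain ⟨C, hC⟩ := hR.exists_eLpNorm_le
  obtain ⟨φ, hφ⟩ := exists_schwartz_tendsto_Lp hs f
  set g : ℕ → Lp ℂ s (volume : Measure (EuclideanSpace ℝ (Fin d))) :=
    fun n => f - (φ n).toLp s volume with hg
  choose G hGm hG hGn using fun n => hR₀.exists_laverage_le hs ht0 ht' hK (g n)
  set u : ℕ → EuclideanSpace ℝ (Fin d) → ℝ≥0∞ := fun n => G n + fun ξ => ‖R (g n) ξ‖ₑ with hu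
  have hum : ∀ n, Measurable (u n) := fun n => (hGm n).add (measurable_enorm_Lp _)
  have hulim : Tendsto (fun n => eLpNorm (u n) t ν) atTop (𝓝 0) := by
    refine tendsto_of_tendsto_of_tendsto_of_le_of_le tendsto_const_nhds
      (tendsto_enorm_sub_schwartz hφ (K + C)) (fun _ => zero_le) fun n => ?_
    dsimp only
    refine (eLpNorm_add_le (hGm n).aestronglyMeasurable
      (measurable_enorm_Lp _).aestronglyMeasurable ht).trans ?_
    rw [eLpNorm_enorm, ENNReal.coe_add, add_mul]
    exact add_le_add (hGn n) (hC _)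
  filter_upwards [ae_liminf_eq_zero ht0 ht' hum hulim,
    ae_all_iff.2 fun n => hR.ae_eq_fourier_sub f (φ n)] with ξ h1 h2
  rw [ENNReal.tendsto_nhds_zero]
  intro ε hε
  have hε2 : 0 < ε / 2 := ENNReal.half_pos hε.ne'
  obtain ⟨n, hn⟩ : ∃ n, u n ξ < ε / 2 := by
    by_contra! hcon
    have : ε / 2 ≤ liminf (fun n => u n ξ) atTop :=
      le_liminf_of_le (by isBoundedDefault) (.of_forall hcon)
    rw [h1] at this
    exact this.not_gt hε2
  filter_upwards [(ENNReal.tendsto_nhds_zero.1 (tendsto_laverage_ellipsoid_of_continuousAt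
    (𝓕 (φ n)).continuous.continuousAt (ξ := ξ))) (ε / 2) hε2] with r hr
  have := isProbabilityMeasure_ellipsoid r ξ
  -- The difference is split into the average of `R₀ (g n)`, the constant `R (g n) ξ`, and the
  -- oscillation of the continuous function `𝓕 (φ n)`; the first two are bounded by `u n ξ` for
  -- every `r`.
  calc ⨍⁻ η in ellipsoid r ξ, ‖R₀ f η - R f ξ‖ₑ ∂volume
      ≤ ⨍⁻ η in ellipsoid r ξ, ‖R₀ (g n) η‖ₑ ∂volume
        + ⨍⁻ η in ellipsoid r ξ, (‖R (g n) ξ‖ₑ + ‖𝓕 (φ n) η - 𝓕 (φ n) ξ‖ₑ) ∂volume := by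
        refine laverage_ellipsoid_le_add r ξ (measurable_enorm_Lp _) ?_
        filter_upwards [hR₀.ae_eq_fourier_sub f (φ n)] with η hη
        rw [hη, h2 n, ← add_assoc]
        refine le_trans (le_of_eq ?_)
          ((enorm_add_le (R₀ f η - 𝓕 (φ n) η - (R f ξ - 𝓕 (φ n) ξ)) _).trans
            (add_le_add_left enorm_sub_le _))
        congr 1
        ring
    _ ≤ ⨍⁻ η in ellipsoid r ξ, ‖R₀ (g n) η‖ₑ ∂volume
        + (⨍⁻ η in ellipsoid r ξ, ‖R (g n) ξ‖ₑ ∂volume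
          + ⨍⁻ η in ellipsoid r ξ, ‖𝓕 (φ n) η - 𝓕 (φ n) ξ‖ₑ ∂volume) := by
        gcongr
        exact laverage_ellipsoid_le_add r ξ measurable_const (.of_forall fun _ => le_rfl)
    _ ≤ G n ξ + (‖R (g n) ξ‖ₑ + ε / 2) := by
        gcongr
        · exact hG n r ξ
        · rw [laverage, lintegral_const, measure_univ, mul_one]
    _ = u n ξ + ε / 2 := (add_assoc _ _ _).symm
    _ ≤ ε / 2 + ε / 2 := by gcongr
    _ = ε := ENNReal.add_halves ε

theorem tendsto_average_of_tendsto_laverage {F : EuclideanSpace ℝ (Fin d) → ℂ}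
    (hF : LocallyIntegrable F volume) {c : ℂ} {ξ : EuclideanSpace ℝ (Fin d)}
    (h : Tendsto (fun r => ⨍⁻ η in ellipsoid r ξ, ‖F η - c‖ₑ ∂volume) (toZero d) (𝓝 0)) :
    Tendsto (fun r => ⨍ η in ellipsoid r ξ, ‖F η - c‖) (toZero d) (𝓝 0) ∧
      Tendsto (fun r => ⨍ η in ellipsoid r ξ, F η) (toZero d) (𝓝 c) := by
  have hFc : ∀ r, IntegrableOn F (ellipsoid r ξ) volume := fun r =>
    hF.integrableOn_isCompact (isCompact_ellipsoid r ξ)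
  have h1 : ∀ r, (⨍⁻ η in ellipsoid r ξ, ‖F η - c‖ₑ ∂volume).toReal
      = ⨍ η in ellipsoid r ξ, ‖F η - c‖ := by
    intro r
    rw [toReal_setLAverage]
    · simp only [toReal_enorm]
    · exact ((hFc r).1.sub aestronglyMeasurable_const).enorm
    · exact .of_forall fun η => enorm_ne_top
  have h2 : Tendsto (fun r => ⨍ η in ellipsoid r ξ, ‖F η - c‖) (toZero d) (𝓝 0) := by
    have := (ENNReal.tendsto_toReal ENNReal.zero_ne_top).comp h
    rw [ENNReal.toReal_zero] at this
    exact this.congr h1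
  refine ⟨h2, ?_⟩
  rw [tendsto_iff_norm_sub_tendsto_zero]
  refine squeeze_zero (fun _ => norm_nonneg _) (fun r => ?_) h2
  have := isProbabilityMeasure_ellipsoid r ξ
  have h3 : Integrable F ((volume.restrict (ellipsoid r ξ) Set.univ)⁻¹ •
      volume.restrict (ellipsoid r ξ)) :=
    (hFc r).smul_measure (by simpa using volume_ellipsoid_ne_zero r ξ)
  rw [average, average]
  have h4 := integral_sub h3 (integrable_const c)
  rw [integral_const, probReal_univ, one_smul] at h4
  rw [← h4]
  exact norm_integral_le_integral_norm _

end LebesguePoints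

end FourierRestriction

namespace FourierRestriction

/-! ### Assembly of the cases `s = 1` and `s > 1`. -/

section Main

variable {d : ℕ} {ν : Measure (EuclideanSpace ℝ (Fin d))}

/-- The Lebesgue point property for the restriction operator. -/
def HasLebesguePoints (ν : Measure (EuclideanSpace ℝ (Fin d))) (s t : ℝ≥0∞) [Fact (1 ≤ s)]
    (R : Lp ℂ s (volume : Measure (EuclideanSpace ℝ (Fin d))) →ₗ[ℂ] Lp ℂ t ν) : Prop :=
  ∀ f : Lp ℂ s (volume : Measure (EuclideanSpace ℝ (Fin d))),
    ∃ F : EuclideanSpace ℝ (Fin d) → ℂ, IsGivenBy (fourierLp f) F ∧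
      (∀ᵐ ξ ∂ν, Tendsto (fun r => ⨍ η in ellipsoid r ξ, ‖F η - R f ξ‖) (toZero d) (𝓝 0)) ∧
      (∀ᵐ ξ ∂ν, Tendsto (fun r => ⨍ η in ellipsoid r ξ, F η) (toZero d) (𝓝 (R f ξ)))

/-- Convergence of the smooth averages to the restriction operator. -/
def HasConvergence (ν : Measure (EuclideanSpace ℝ (Fin d))) (s t : ℝ≥0∞) [Fact (1 ≤ s)]
    (R : Lp ℂ s (volume : Measure (EuclideanSpace ℝ (Fin d))) →ₗ[ℂ] Lp ℂ t ν) : Prop :=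
  ∀ χ : 𝓢(EuclideanSpace ℝ (Fin d), ℂ), ∫ x, χ x = 1 →
    ∀ f : Lp ℂ s (volume : Measure (EuclideanSpace ℝ (Fin d))),
      ∀ᵐ ξ ∂ν, Tendsto (fun r => conv (fourierLp f) (dilate χ r) ξ) (toZero d) (𝓝 (R f ξ))

theorem hasLebesguePoints_of_ae_tendsto_laverage {s t : ℝ≥0∞} [Fact (1 ≤ s)]
    {R : Lp ℂ s (volume : Measure (EuclideanSpace ℝ (Fin d))) →ₗ[ℂ] Lp ℂ t ν}
    (h : ∀ f : Lp ℂ s (volume : Measure (EuclideanSpace ℝ (Fin d))),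
      ∃ F : EuclideanSpace ℝ (Fin d) → ℂ, IsGivenBy (fourierLp f) F ∧
        ∀ᵐ ξ ∂ν, Tendsto (fun r => ⨍⁻ η in ellipsoid r ξ, ‖F η - R f ξ‖ₑ ∂volume)
          (toZero d) (𝓝 0)) :
    HasLebesguePoints ν s t R := by
  intro f
  obtain ⟨F, hF, hlim⟩ := h f
  exact ⟨F, hF, hlim.mono fun ξ hξ => (tendsto_average_of_tendsto_laverage hF.1 hξ).1,
    hlim.mono fun ξ hξ => (tendsto_average_of_tendsto_laverage hF.1 hξ).2⟩

/-- Theory of the restriction operator on `L¹`. -/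
theorem restriction_of_one {t : ℝ≥0∞} (ht : t = ∞) :
    (∃! R : Lp ℂ 1 (volume : Measure (EuclideanSpace ℝ (Fin d))) →ₗ[ℂ] Lp ℂ t ν,
      IsRestrictionOperator ν 1 t R) ∧
    ∀ R : Lp ℂ 1 (volume : Measure (EuclideanSpace ℝ (Fin d))) →ₗ[ℂ] Lp ℂ t ν,
      IsRestrictionOperator ν 1 t R → HasConvergence ν 1 t R ∧ HasLebesguePoints ν 1 t R := by
  subst ht
  refine ⟨existsUnique_isRestrictionOperator ENNReal.one_ne_top le_top (aPrioriEstimate_one_top ν),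
    fun R hR => ⟨fun χ hχ f => ?_, hasLebesguePoints_of_ae_tendsto_laverage fun f => ?_⟩⟩
  · filter_upwards [hR.ae_eq_fourier_of_one f] with ξ hξ
    rw [hξ]
    exact tendsto_conv_of_integrable f (L1.integrable_coeFn f) hχ ξ
  · refine ⟨𝓕 (f : EuclideanSpace ℝ (Fin d) → ℂ), ?_, ?_⟩
    · obtain ⟨R₀, hR₀, -⟩ := existsUnique_isRestrictionOperator (d := d) (ν := volume)
        ENNReal.one_ne_top le_top (aPrioriEstimate_one_top volume)
      exact (hR₀.isGivenBy ENNReal.one_ne_top le_top f).congr (hR₀.ae_eq_fourier_of_one f)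
    · filter_upwards [hR.ae_eq_fourier_of_one f] with ξ hξ
      rw [hξ]
      exact tendsto_laverage_ellipsoid_of_continuousAt
        (continuous_fourier_of_integrable (L1.integrable_coeFn f)).continuousAt

/-- Theory of the restriction operator on `Lˢ`, `s > 1`. -/
theorem restriction_of_one_lt {s p q : ℝ} [Fact (1 ≤ ENNReal.ofReal s)] (hs : 1 < s) (hsp : s ≤ p)
    (hpq : p < q) (hest : APrioriEstimate ν (ENNReal.ofReal p) (ENNReal.ofReal q))
    {t : ℝ≥0∞} (ht : t = ENNReal.ofReal (q * (s / (s - 1)) / (p / (p - 1)))) :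
    (∃! R : Lp ℂ (ENNReal.ofReal s) (volume : Measure (EuclideanSpace ℝ (Fin d))) →ₗ[ℂ] Lp ℂ t ν,
      IsRestrictionOperator ν (ENNReal.ofReal s) t R) ∧
    ∀ R : Lp ℂ (ENNReal.ofReal s) (volume : Measure (EuclideanSpace ℝ (Fin d))) →ₗ[ℂ] Lp ℂ t ν,
      IsRestrictionOperator ν (ENNReal.ofReal s) t R →
        HasConvergence ν (ENNReal.ofReal s) t R ∧
        (s ≤ 2 * p / (p + 1) → HasLebesguePoints ν (ENNReal.ofReal s) t R) := by
  have hp : 1 < p := hs.trans_le hsp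
  have hqt : q ≤ q * (s / (s - 1)) / (p / (p - 1)) := le_exponent hs hsp hpq.le
  have hst : s < q * (s / (s - 1)) / (p / (p - 1)) := by linarith
  have ht1 : 1 ≤ t := by
    rw [ht, ENNReal.one_le_ofReal]; linarith
  have htop : t ≠ ∞ := ht ▸ ENNReal.ofReal_ne_top
  have hst' : ENNReal.ofReal s < t := by
    rw [ht]; exact (ENNReal.ofReal_lt_ofReal_iff (by linarith)).2 hst
  have hest' : APrioriEstimate ν (ENNReal.ofReal s) t := ht ▸ hest.of_le hs hsp hpq.le
  refine ⟨existsUnique_isRestrictionOperator ENNReal.ofReal_ne_top ht1 hest',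
    fun R hR => ⟨fun χ hχ f => hR.ae_tendsto_conv ENNReal.ofReal_ne_top ht1 htop hχ
      (exists_eLpNorm_maximalFunction_le hst' htop hest' χ) f, fun hs2 => ?_⟩⟩
  have hs2' : s * (p + 1) ≤ 2 * p := (le_div_iff₀ (by linarith)).1 hs2
  have hslt : s < 2 := by nlinarith
  have h2s : 0 < 2 - s := by linarith
  -- Here `p'` is not a conjugate exponent but the solution of `2/s = 1 + 1/p'`, the Lebesgue
  -- exponent of the autocorrelation; `p' ≤ p` is equivalent to `s ≤ 2p/(p+1)`.
  set p' := s / (2 - s) with hp'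
  have hsp' : s ≤ p' := by rw [hp', le_div_iff₀ h2s]; nlinarith
  have hp'p : p' ≤ p := by rw [hp', div_le_iff₀ h2s]; nlinarith
  have hp'1 : 1 < p' := hs.trans_le hsp'
  have hqq := le_exponent hp'1 hp'p hpq.le
  have h2 : 2 / s = 1 + 1 / p' := by rw [hp']; field_simp; ring
  -- The conjugate of `s` is twice the conjugate of `p'`, so the target exponent at `s` is twice the
  -- one at `p'`, matching the doubling caused by the square root.
  have htt : t = ENNReal.ofReal (2 * (q * (p' / (p' - 1)) / (p / (p - 1)))) := by
    rw [ht]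
    congr 1
    have e : s / (s - 1) = 2 * (p' / (p' - 1)) := by
      have h3 : p' - 1 = 2 * (s - 1) / (2 - s) := by rw [hp']; field_simp; ring
      have h4 : s - 1 ≠ 0 := by linarith
      rw [h3, hp']
      field_simp
    rw [e]
    ring
  obtain ⟨K, hK⟩ := exists_laverage_fourier_le hs.le hsp' (hp'p.trans_lt (hpq.trans_le hqq)) h2
    (hest.of_le hp'1 hp'p hpq.le)
  rw [← htt] at hK
  obtain ⟨R₀, hR₀, -⟩ := existsUnique_isRestrictionOperator (d := d) (ν := volume)
    (s := ENNReal.ofReal s) ENNReal.ofReal_ne_top le_self_add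
    (aPrioriEstimate_conjExponent (by simpa using hs.le) (by simpa using hslt.le))
  exact hasLebesguePoints_of_ae_tendsto_laverage fun f =>
    ⟨R₀ f, hR₀.isGivenBy ENNReal.ofReal_ne_top le_self_add f,
      hR.ae_tendsto_laverage ENNReal.ofReal_ne_top ht1 htop hR₀ hK f⟩

end Main

end FourierRestriction

open FourierRestriction in
theorem theorem1 (d : ℕ) (hd : 0 < d)
    (σ : Measure (EuclideanSpace ℝ (Fin d))) [SigmaFinite σ]
    (S : Set (EuclideanSpace ℝ (Fin d))) (hS : MeasurableSet S) (hσS : σ Sᶜ = 0)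
    (p q : ℝ≥0∞) [Fact (1 ≤ p)] (hp : 1 < p) (hpq : p < q) (hq : q < ∞)
    (hest : APrioriEstimate (σ.restrict S) p q) :
    -- (a) the multi-parameter maximal estimate
    (∀ χ : 𝓢(EuclideanSpace ℝ (Fin d), ℂ), ∃ C : ℝ≥0,
      ∀ f : Lp ℂ p (volume : Measure (EuclideanSpace ℝ (Fin d))),
        Measurable (maximalFunction (fourierLp f) χ) ∧
        eLpNorm (maximalFunction (fourierLp f) χ) q (σ.restrict S) ≤ C * eLpNorm f p volume) ∧
    ∀ (s : ℝ≥0∞) [Fact (1 ≤ s)], s ≤ p →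
      -- the Fourier restriction operator on `L^s` exists and is unique
      (∃! R : Lp ℂ s (volume : Measure (EuclideanSpace ℝ (Fin d))) →ₗ[ℂ]
          Lp ℂ (q * s.conjExponent / p.conjExponent) (σ.restrict S),
        IsRestrictionOperator (σ.restrict S) s (q * s.conjExponent / p.conjExponent) R) ∧
      ∀ R : Lp ℂ s (volume : Measure (EuclideanSpace ℝ (Fin d))) →ₗ[ℂ]
          Lp ℂ (q * s.conjExponent / p.conjExponent) (σ.restrict S),
        IsRestrictionOperator (σ.restrict S) s (q * s.conjExponent / p.conjExponent) R →
        -- (b) multi-parameter convergence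
        (∀ χ : 𝓢(EuclideanSpace ℝ (Fin d), ℂ), ∫ x, χ x = 1 →
          ∀ f : Lp ℂ s (volume : Measure (EuclideanSpace ℝ (Fin d))),
            ∀ᵐ ξ ∂(σ.restrict S),
              Tendsto (fun r => conv (fourierLp f) (dilate χ r) ξ) (toZero d) (𝓝 (R f ξ))) ∧
        -- (c) the multi-parameter Lebesgue point property and convergence of the averages
        (s ≤ 2 * p / (p + 1) →
          ∀ f : Lp ℂ s (volume : Measure (EuclideanSpace ℝ (Fin d))),
            ∃ F : EuclideanSpace ℝ (Fin d) → ℂ, IsGivenBy (fourierLp f) F ∧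
              (∀ᵐ ξ ∂(σ.restrict S),
                Tendsto (fun r => ⨍ η in ellipsoid r ξ, ‖F η - R f ξ‖) (toZero d) (𝓝 0)) ∧
              (∀ᵐ ξ ∂(σ.restrict S),
                Tendsto (fun r => ⨍ η in ellipsoid r ξ, F η) (toZero d) (𝓝 (R f ξ)))) := by
  have hptop : p ≠ ∞ := (hpq.trans hq).ne
  have hp' := ENNReal.ofReal_toReal hptop
  have hq' := ENNReal.ofReal_toReal hq.ne
  have hp1 : 1 < p.toReal := by
    rwa [← hp', ENNReal.one_lt_ofReal] at hp
  have hpq' : p.toReal < q.toReal := (ENNReal.toReal_lt_toReal hptop hq.ne).2 hpq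
  refine ⟨fun χ => ?_, fun s hs1 hsp => ?_⟩
  · obtain ⟨C, hC⟩ := exists_eLpNorm_maximalFunction_le hpq hq.ne hest χ
    exact ⟨C, fun f => ⟨measurable_maximalFunction _ χ, hC f⟩⟩
  · rcases hs1.out.eq_or_lt with h1 | h1
    -- For `s = 1` the conjugate exponent, and with it the target exponent, is `∞`.
    · subst h1
      have ht : q * (1 : ℝ≥0∞).conjExponent / p.conjExponent = ∞ := by
        rw [conjExponent_one, ENNReal.mul_top ((zero_le.trans_lt hpq).ne'),
          ENNReal.top_div_of_ne_top]
        rw [← hp', conjExponent_ofReal hp1]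
        exact ENNReal.ofReal_ne_top
      obtain ⟨hex, h⟩ := restriction_of_one (ν := σ.restrict S) ht
      exact ⟨hex, fun R hR => ⟨(h R hR).1, fun _ => (h R hR).2⟩⟩
    · have hs_fin : s ≠ ∞ := ne_top_of_le_ne_top hptop hsp
      obtain ⟨s, rfl⟩ : ∃ x : ℝ, s = ENNReal.ofReal x := ⟨_, (ENNReal.ofReal_toReal hs_fin).symm⟩
      rw [ENNReal.one_lt_ofReal] at h1
      have hsp' : s ≤ p.toReal := (ENNReal.ofReal_le_iff_le_toReal hptop).1 hsp
      have ht : q * (ENNReal.ofReal s).conjExponent / p.conjExponent = ENNReal.ofReal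
          (q.toReal * (s / (s - 1)) / (p.toReal / (p.toReal - 1))) := by
        rw [← exponent_eq_ofReal h1 hp1 (by linarith), hp', hq']
      obtain ⟨hex, h⟩ := restriction_of_one_lt (ν := σ.restrict S) h1 hsp' hpq'
        (by rwa [hp', hq']) ht
      refine ⟨hex, fun R hR => ⟨(h R hR).1, fun hs2 => (h R hR).2 ?_⟩⟩
      have h3 := (ENNReal.ofReal_le_iff_le_toReal
        (ENNReal.div_ne_top (ENNReal.mul_ne_top ENNReal.ofNat_ne_top hptop) (by simp))).1 hs2
      rwa [ENNReal.toReal_div, ENNReal.toReal_mul, ENNReal.toReal_add hptop ENNReal.one_ne_top,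
        ENNReal.toReal_ofNat, ENNReal.toReal_one] at h3
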